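/- Let $\Bbbk$ be a commutative ring and let $R$ be an associative (unital) $\Bbbk$-algebra. "$R$-module" means left $R$-module, and $R^\circ$-modules are right $R$-modules. Let $M$ be an $R^\circ$-module, $P\to M$ a projective resolution and, for an $R$-module $N$, let $N\to I$ be an injective resolution with cosyzygies $\Omega^kN=\operatorname{Ker}(I^k\to I^{k+1})$, so that $\Omega^0N=N$. *Complete homology.* Put $\operatorname{Tor}_n^R(M,-)=0$ for $n<0$. For $k\ge 1$ the $k$-th right satellite of a functor $T$ from $R$-modules to $\Bbbk$-modules is $S^kT(N)=\operatorname{Coker}\big(T(I^{k-1})\to T(\Omega^kN)\big)$, and $S^0T=T$. The connecting homomorphisms $\operatorname{Tor}_{k+i}^R(M,\Omega^kN)\to\operatorname{Tor}_{k+i-1}^R(M,\Omega^{k-1}N)$ of the exact sequences $0\to\Omega^{k-1}N\to I^{k-1}\to\Omega^kN\to0$ induce maps $S^k\operatorname{Tor}^R_{k+i}(M,-)(N)\to S^{k-1}\operatorname{Tor}^R_{k-1+i}(M,-)(N)$, and complete homology, i.e. the J-completion of $\operatorname{Tor}$, is $$\widecheck{\operatorname{Tor}}{}^R_i(M,N)=\lim_{k\ge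 0}S^k\operatorname{Tor}^R_{k+i}(M,-)(N)\qquad(i\in\mathbb Z).$$ *Stable homology.* Let $P\mathbin{\overline\otimes_R}I$ be the complex with $(P\mathbin{\overline\otimes_R}I)_n=\prod_j P_{j+n}\otimes_R I^j$ and differential extending $p\otimes x\mapsto\partial p\otimes x+(-1)^{|p|}p\otimes\partial x$, and let $P\otimes_RI$ be its subcomplex with components $\coprod_jP_{j+n}\otimes_RI^j$. Stable homology is $$\widetilde{\operatorname{Tor}}{}^R_i(M,N)=H_{i+1}\big((P\mathbin{\overline\otimes_R}I)/(P\otimes_RI)\big)\qquad(i\in\mathbb Z).$$ **Statement.** Assume that $R$ is right noetherian, that $M$ is a finitely generated $R^\circ$-module, and that there is an integer $n$ with $\operatorname{Ext}^i_{R^\circ}(M,R)=0$ for all $i\ge n$. Then for every $i\in\mathbb Z$ there is an isomorphism $$\widecheck{\operatorname{Tor}}{}^R_i(M,-)\;\cong\;\widetilde{\operatorname{Tor}}{}^R_i(M,-)$$ of functors from the category of all $R$-modules to the category of $\Bbbk$-modules. -/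

import Mathlib

open CategoryTheory CategoryTheory.Limits

universe w u

namespace CompleteHomology

noncomputable section

/-! ## The tensor product over an associative algebra

`R` is an associative algebra over the commutative ring `𝕜`; right `R`-modules are modules over
`Rᵐᵒᵖ`, and `MulOpposite.op r • m` is `m · r`. -/

section Tensor

variable (𝕜 : Type w) (R : Type u) [CommRing 𝕜] [Ring R] [Algebra 𝕜 R]

/-- The `𝕜`-module `M ⊗_𝕜 N`, the actions of `𝕜` coming from the structure map `𝕜 → R`. -/
abbrev PreTensor (M N : Type u) [AddCommGroup M] [Module Rᵐᵒᵖ M] [AddCommGroup N] [Module R N] :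
    Type u :=
  @TensorProduct 𝕜 _ M N _ _ (Module.restrictScalars 𝕜 Rᵐᵒᵖ M) (Module.restrictScalars 𝕜 R N)

/-- The submodule of `M ⊗_𝕜 N` generated by all `(m · r) ⊗ n - m ⊗ (r · n)`. -/
def balancing (M N : Type u) [AddCommGroup M] [Module Rᵐᵒᵖ M] [AddCommGroup N] [Module R N] :
    Submodule 𝕜 (PreTensor 𝕜 R M N) :=
  letI := Module.restrictScalars 𝕜 Rᵐᵒᵖ M
  letI := Module.restrictScalars 𝕜 R N
  Submodule.span 𝕜 {x | ∃ (m : M) (r : R) (n : N),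
    x = TensorProduct.tmul 𝕜 (MulOpposite.op r • m) n - TensorProduct.tmul 𝕜 m (r • n)}

/-- The tensor product `M ⊗_R N` of a right `R`-module and a left `R`-module, a `𝕜`-module. -/
def RTensor (M N : Type u) [AddCommGroup M] [Module Rᵐᵒᵖ M] [AddCommGroup N] [Module R N] :
    Type u :=
  PreTensor 𝕜 R M N ⧸ balancing 𝕜 R M N

namespace RTensor

section
variable (M N : Type u) [AddCommGroup M] [Module Rᵐᵒᵖ M] [AddCommGroup N] [Module R N]

instance : AddCommGroup (RTensor 𝕜 R M N) :=
  inferInstanceAs (AddCommGroup (PreTensor 𝕜 R M N ⧸ balancing 𝕜 R M N))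

instance : Module 𝕜 (RTensor 𝕜 R M N) :=
  inferInstanceAs (Module 𝕜 (PreTensor 𝕜 R M N ⧸ balancing 𝕜 R M N))

end

variable {R}
variable {M N M' N' M'' N'' : Type u}
  [AddCommGroup M] [Module Rᵐᵒᵖ M] [AddCommGroup N] [Module R N]
  [AddCommGroup M'] [Module Rᵐᵒᵖ M'] [AddCommGroup N'] [Module R N']
  [AddCommGroup M''] [Module Rᵐᵒᵖ M''] [AddCommGroup N''] [Module R N'']

variable (R) in
/-- The class of `m ⊗ n` in `M ⊗_R N`. -/
def tmul (m : M) (n : N) : RTensor 𝕜 R M N :=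
  letI := Module.restrictScalars 𝕜 Rᵐᵒᵖ M
  letI := Module.restrictScalars 𝕜 R N
  (balancing 𝕜 R M N).mkQ (TensorProduct.tmul 𝕜 m n)

lemma add_tmul (m m' : M) (n : N) : tmul 𝕜 R (m + m') n = tmul 𝕜 R m n + tmul 𝕜 R m' n := by
  let _ := Module.restrictScalars 𝕜 Rᵐᵒᵖ M
  let _ := Module.restrictScalars 𝕜 R N
  exact (congrArg (balancing 𝕜 R M N).mkQ (TensorProduct.add_tmul m m' n)).trans (map_add _ _ _)

lemma tmul_add (m : M) (n n' : N) : tmul 𝕜 R m (n + n') = tmul 𝕜 R m n + tmul 𝕜 R m n' := by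
  let _ := Module.restrictScalars 𝕜 Rᵐᵒᵖ M
  let _ := Module.restrictScalars 𝕜 R N
  exact (congrArg (balancing 𝕜 R M N).mkQ (TensorProduct.tmul_add m n n')).trans (map_add _ _ _)

lemma op_smul_tmul (m : M) (r : R) (n : N) :
    tmul 𝕜 R (MulOpposite.op r • m) n = tmul 𝕜 R m (r • n) := by
  let _ := Module.restrictScalars 𝕜 Rᵐᵒᵖ M
  let _ := Module.restrictScalars 𝕜 R N
  exact (Submodule.Quotient.eq _).2 (Submodule.subset_span ⟨m, r, n, rfl⟩)

lemma smul_tmul (c : 𝕜) (m : M) (n : N) :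
    c • tmul 𝕜 R m n = tmul 𝕜 R m (algebraMap 𝕜 R c • n) := by
  let _ := Module.restrictScalars 𝕜 Rᵐᵒᵖ M
  let _ := Module.restrictScalars 𝕜 R N
  exact ((map_smul (balancing 𝕜 R M N).mkQ c (TensorProduct.tmul 𝕜 m n)).symm).trans
    (congrArg (balancing 𝕜 R M N).mkQ (TensorProduct.tmul_smul c m n).symm)

@[elab_as_elim]
lemma induction_on {p : RTensor 𝕜 R M N → Prop} (x : RTensor 𝕜 R M N) (zero : p 0)
    (tmul : ∀ m n, p (tmul 𝕜 R m n)) (add : ∀ x y, p x → p y → p (x + y)) : p x := by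
  let _ := Module.restrictScalars 𝕜 Rᵐᵒᵖ M
  let _ := Module.restrictScalars 𝕜 R N
  obtain ⟨y, rfl⟩ := (balancing 𝕜 R M N).mkQ_surjective x
  induction y using TensorProduct.induction_on with
  | zero => rw [map_zero]; exact zero
  | tmul m n => exact tmul m n
  | add a b ha hb => rw [map_add]; exact add _ _ ha hb

/-- Additive maps out of `M ⊗_R N` from balanced biadditive maps. -/
def liftAdd {G : Type u} [AddCommGroup G] (f : M →+ N →+ G)
    (hf : ∀ m (r : R) n, f (MulOpposite.op r • m) n = f m (r • n)) : RTensor 𝕜 R M N →+ G :=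
  letI := Module.restrictScalars 𝕜 Rᵐᵒᵖ M
  letI := Module.restrictScalars 𝕜 R N
  haveI hf' : ∀ (c : 𝕜) (m : M) (n : N), f (c • m) n = f m (c • n) :=
    fun c m n => hf m (algebraMap 𝕜 R c) n
  QuotientAddGroup.lift (balancing 𝕜 R M N).toAddSubgroup (TensorProduct.liftAddHom f hf') (by
      intro x hx
      suffices h : ∀ c : 𝕜, TensorProduct.liftAddHom f hf' (c • x) = 0 by
        have := h 1
        rwa [one_smul] at this
      replace hx : x ∈ balancing 𝕜 R M N := hx
      unfold balancing at hx
      induction hx using Submodule.span_induction with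
      | mem x hx' =>
        obtain ⟨m, r, n, rfl⟩ := hx'
        intro c
        rw [smul_sub, map_sub, TensorProduct.smul_tmul', TensorProduct.smul_tmul',
          TensorProduct.liftAddHom_tmul, TensorProduct.liftAddHom_tmul, sub_eq_zero, ← hf]
        have : c • MulOpposite.op r • m = MulOpposite.op r • c • m := by
          change (algebraMap 𝕜 Rᵐᵒᵖ c) • MulOpposite.op r • m =
            MulOpposite.op r • (algebraMap 𝕜 Rᵐᵒᵖ c) • m
          rw [← mul_smul, ← mul_smul, Algebra.commutes]
        rw [this]
      | zero => intro c; rw [smul_zero, map_zero]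
      | add x y hx hy h₁ h₂ => intro c; rw [smul_add, map_add, h₁, h₂, add_zero]
      | smul a x hx h => intro c; rw [smul_smul]; exact h _)

@[simp] lemma liftAdd_tmul {G : Type u} [AddCommGroup G] (f : M →+ N →+ G)
    (hf : ∀ m (r : R) n, f (MulOpposite.op r • m) n = f m (r • n)) (m : M) (n : N) :
    liftAdd 𝕜 f hf (tmul 𝕜 R m n) = f m n := rfl

/-- The additive map underlying `f ⊗_R g`. -/
def mapAdd (f : M →ₗ[Rᵐᵒᵖ] M') (g : N →ₗ[R] N') : RTensor 𝕜 R M N →+ RTensor 𝕜 R M' N' :=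
  liftAdd 𝕜 (AddMonoidHom.mk' (fun m => AddMonoidHom.mk' (fun n => tmul 𝕜 R (f m) (g n))
      (fun a b => by rw [map_add, tmul_add]))
      (fun a b => by ext n; simp [add_tmul]))
      (fun m r n => by simp [op_smul_tmul])

/-- The `𝕜`-linear map `f ⊗_R g`. -/
def map (f : M →ₗ[Rᵐᵒᵖ] M') (g : N →ₗ[R] N') : RTensor 𝕜 R M N →ₗ[𝕜] RTensor 𝕜 R M' N' where
  toFun := mapAdd 𝕜 f g
  map_add' := map_add _
  map_smul' c x := by
    induction x using induction_on with
    | zero => simp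
    | tmul m n =>
      rw [smul_tmul]
      refine Eq.trans ?_ (smul_tmul 𝕜 c (f m) (g n)).symm
      exact congrArg (tmul 𝕜 R (f m)) (map_smul g (algebraMap 𝕜 R c) n)
    | add x y hx hy => rw [smul_add, map_add, map_add, hx, hy, smul_add]

@[simp] lemma map_tmul (f : M →ₗ[Rᵐᵒᵖ] M') (g : N →ₗ[R] N') (m : M) (n : N) :
    map 𝕜 f g (tmul 𝕜 R m n) = tmul 𝕜 R (f m) (g n) := rfl

lemma hom_ext {G : Type*} [AddCommGroup G] [Module 𝕜 G] {f g : RTensor 𝕜 R M N →ₗ[𝕜] G}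
    (h : ∀ m n, f (tmul 𝕜 R m n) = g (tmul 𝕜 R m n)) : f = g := by
  ext x
  induction x using induction_on with
  | zero => simp
  | tmul m n => exact h m n
  | add x y hx hy => rw [map_add, map_add, hx, hy]

lemma map_id : map 𝕜 (LinearMap.id : M →ₗ[Rᵐᵒᵖ] M) (LinearMap.id : N →ₗ[R] N) = LinearMap.id :=
  hom_ext 𝕜 fun _ _ => rfl

lemma map_comp (f : M →ₗ[Rᵐᵒᵖ] M') (f' : M' →ₗ[Rᵐᵒᵖ] M'') (g : N →ₗ[R] N') (g' : N' →ₗ[R] N'') :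
    map 𝕜 (f' ∘ₗ f) (g' ∘ₗ g) = map 𝕜 f' g' ∘ₗ map 𝕜 f g :=
  hom_ext 𝕜 fun _ _ => rfl

@[simp] lemma zero_tmul (n : N) : tmul 𝕜 R (0 : M) n = (0 : RTensor 𝕜 R M N) := by
  have h := add_tmul 𝕜 (R := R) (0 : M) 0 n
  rw [add_zero] at h
  exact left_eq_add.1 h

@[simp] lemma tmul_zero (m : M) : tmul 𝕜 R m (0 : N) = (0 : RTensor 𝕜 R M N) := by
  have h := tmul_add 𝕜 (R := R) m (0 : N) 0
  rw [add_zero] at h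
  exact left_eq_add.1 h

@[simp] lemma map_zero_left (g : N →ₗ[R] N') : map 𝕜 (0 : M →ₗ[Rᵐᵒᵖ] M') g = 0 :=
  hom_ext 𝕜 fun _ _ => by simp

@[simp] lemma map_zero_right (f : M →ₗ[Rᵐᵒᵖ] M') : map 𝕜 f (0 : N →ₗ[R] N') = 0 :=
  hom_ext 𝕜 fun _ _ => by simp

/-! Tensoring with a projective right module is exact: a dual basis exhibits `M ⊗_R -` as a
retract of a direct sum of copies of the identity. -/

section Flat

set_option linter.unusedSectionVars false

variable [Module.Projective Rᵐᵒᵖ M]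

variable (R M) in
/-- A splitting of the canonical surjection from the free module on the set `M`. -/
def dualBasis : M →ₗ[Rᵐᵒᵖ] M →₀ Rᵐᵒᵖ :=
  (Module.projective_def'.1 (‹_› : Module.Projective Rᵐᵒᵖ M)).choose

lemma dualBasis_sum (m : M) : ((dualBasis R M m).sum fun b r => r • b) = m := by
  exact LinearMap.congr_fun (Module.projective_def'.1 (‹_› : Module.Projective Rᵐᵒᵖ M)).choose_spec m

variable (M N) in
/-- Coordinates of elements of `M ⊗_R N` with respect to a dual basis. -/
def coords : RTensor 𝕜 R M N →+ (M →₀ N) :=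
  liftAdd 𝕜 (AddMonoidHom.mk' (fun m => AddMonoidHom.mk'
      (fun n => (dualBasis R M m).mapRange (fun r => r.unop • n) (by simp))
      (fun a b => by ext; simp))
      (fun a b => by ext; simp [add_smul]))
    (fun m r n => by ext; simp [mul_smul])

variable (M N) in
/-- The map back from coordinates. -/
def uncoords : (M →₀ N) →+ RTensor 𝕜 R M N :=
  Finsupp.liftAddHom fun b => AddMonoidHom.mk' (fun n => tmul 𝕜 R b n) (tmul_add 𝕜 b)

lemma uncoords_coords (x : RTensor 𝕜 R M N) : uncoords 𝕜 M N (coords 𝕜 M N x) = x := by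
  induction x using induction_on with
  | zero => simp
  | tmul m n =>
    have h : uncoords 𝕜 M N (coords 𝕜 M N (tmul 𝕜 R m n)) =
        (dualBasis R M m).sum fun b r => tmul 𝕜 R (r • b) n := by
      simp only [uncoords, coords, liftAdd_tmul, AddMonoidHom.mk'_apply, Finsupp.liftAddHom_apply]
      rw [Finsupp.sum_mapRange_index (by simp)]
      refine Finsupp.sum_congr fun b _ => ?_
      exact (op_smul_tmul 𝕜 b _ n).symm
    rw [h]
    conv_rhs => rw [← dualBasis_sum (R := R) m]
    exact (map_finsuppSum (AddMonoidHom.mk' (fun m : M => tmul 𝕜 R m n)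
      (fun a b => add_tmul 𝕜 a b n)) (dualBasis R M m) (fun b r => r • b)).symm
  | add x y hx hy => rw [map_add, map_add, hx, hy]

lemma coords_map (g : N →ₗ[R] N') (x : RTensor 𝕜 R M N) :
    coords 𝕜 M N' (map 𝕜 LinearMap.id g x) =
      (coords 𝕜 M N x).mapRange g (map_zero g) := by
  induction x using induction_on with
  | zero => simp
  | tmul m n => ext b; simp [coords]
  | add x y hx hy =>
    rw [map_add, map_add, hx, hy, map_add]
    ext b; simp

lemma uncoords_map (g : N →ₗ[R] N') (y : M →₀ N) :
    uncoords 𝕜 M N' (y.mapRange g (map_zero g)) = map 𝕜 LinearMap.id g (uncoords 𝕜 M N y) := by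
  induction y using Finsupp.induction_linear with
  | zero => simp
  | add x y hx hy =>
    rw [Finsupp.mapRange_add (fun a b => map_add g a b), map_add, hx, hy, map_add, map_add]
  | single b n => simp [uncoords]

lemma map_injective (g : N →ₗ[R] N') (hg : Function.Injective g) :
    Function.Injective (map 𝕜 (LinearMap.id : M →ₗ[Rᵐᵒᵖ] M) g) := by
  intro x y h
  have h' := congrArg (coords 𝕜 M N') h
  rw [coords_map, coords_map] at h'
  rw [← uncoords_coords 𝕜 x, ← uncoords_coords 𝕜 y,
    Finsupp.mapRange_injective _ (map_zero g) hg h']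

lemma map_exact (g : N →ₗ[R] N') (g' : N' →ₗ[R] N'') (hg : Function.Exact g g') :
    Function.Exact (map 𝕜 (LinearMap.id : M →ₗ[Rᵐᵒᵖ] M) g) (map 𝕜 LinearMap.id g') := by
  intro x
  constructor
  · intro h
    have h' := congrArg (coords 𝕜 M N'') h
    rw [coords_map, map_zero] at h'
    have hy : ∃ y : M →₀ N, y.mapRange g (map_zero g) = coords 𝕜 M N' x := by
      have hx : ∀ b, ∃ n, g n = coords 𝕜 M N' x b := fun b =>
        (hg _).1 (by simpa using DFunLike.congr_fun h' b)
      choose s hs using hx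
      classical
      refine ⟨Finsupp.onFinset (coords 𝕜 M N' x).support
        (fun b => if coords 𝕜 M N' x b = 0 then 0 else s b) (by simp; tauto), ?_⟩
      ext b
      by_cases hb : coords 𝕜 M N' x b = 0 <;> simp [hb, hs]
    obtain ⟨y, hy⟩ := hy
    exact ⟨uncoords 𝕜 M N y, by rw [← uncoords_map, hy, uncoords_coords]⟩
  · rintro ⟨y, rfl⟩
    rw [← LinearMap.comp_apply, ← map_comp, LinearMap.id_comp, hg.linearMap_comp_eq_zero]
    simp

end Flat

lemma map_surjective (g : N →ₗ[R] N') (hg : Function.Surjective g) :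
    Function.Surjective (map 𝕜 (LinearMap.id : M →ₗ[Rᵐᵒᵖ] M) g) := by
  intro x
  induction x using induction_on with
  | zero => exact ⟨0, map_zero _⟩
  | tmul m n => obtain ⟨n, rfl⟩ := hg n; exact ⟨tmul 𝕜 R m n, rfl⟩
  | add x y hx hy =>
    obtain ⟨a, rfl⟩ := hx
    obtain ⟨b, rfl⟩ := hy
    exact ⟨a + b, map_add _ _ _⟩

end RTensor

end Tensor

/-! ## A functorial injective resolution -/

section InjectiveResolution

variable (R : Type u) [Ring R]

/-- The functor sending `N` to the morphism `N ⟶ 0`. -/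
def toZeroArrow : ModuleCat.{u} R ⥤ Arrow (ModuleCat.{u} R) where
  obj N := Arrow.mk (0 : N ⟶ ModuleCat.of R PUnit)
  map f := Arrow.homMk f (𝟙 _) (by simp)

/-- A functorial factorization of morphisms of `R`-modules into a monomorphism followed by a
morphism with the right lifting property with respect to all monomorphisms. -/
def factorization : MorphismProperty.FunctorialFactorizationData
    (MorphismProperty.monomorphisms (ModuleCat.{u} R))
    (MorphismProperty.monomorphisms (ModuleCat.{u} R)).rlp :=
  MorphismProperty.functorialFactorizationData _ _

/-- `J N` is an injective module containing `N`, functorially in `N`. -/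
def J : ModuleCat.{u} R ⥤ ModuleCat.{u} R := toZeroArrow R ⋙ (factorization R).Z

/-- The embedding of `N` into the injective module `J N`. -/
def ι : 𝟭 (ModuleCat.{u} R) ⟶ J R where
  app N := (factorization R).i.app ((toZeroArrow R).obj N)
  naturality _ _ f := (factorization R).i.naturality ((toZeroArrow R).map f)

instance (N : ModuleCat.{u} R) : Mono ((ι R).app N) := (factorization R).hi _

instance (N : ModuleCat.{u} R) : Injective ((J R).obj N) := by
  have hz : IsZero (ModuleCat.of R PUnit.{u + 1}) := ModuleCat.isZero_of_subsingleton _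
  exact (injective_iff_rlp_monomorphisms_of_isZero
    ((factorization R).p.app ((toZeroArrow R).obj N)) hz).2 ((factorization R).hp _)

/-- The first cosyzygy `Ω N = J N / N`. -/
def Ω : ModuleCat.{u} R ⥤ ModuleCat.{u} R where
  obj N := cokernel ((ι R).app N)
  map f := cokernel.map _ _ f ((J R).map f) ((ι R).naturality f).symm
  map_id N := by ext1; simp
  map_comp f g := by
    refine coequalizer.hom_ext ?_
    refine (cokernel.π_desc _ _ _).trans ?_
    refine Eq.trans ?_ (cokernel.π_desc_assoc _ _ _ _).symm
    rw [Functor.map_comp, Category.assoc, Category.assoc]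
    exact congrArg _ (cokernel.π_desc _ _ _).symm

/-- The projection `J N ⟶ Ω N`. -/
def π : J R ⟶ Ω R where
  app N := cokernel.π ((ι R).app N)
  naturality _ _ _ := (cokernel.π_desc _ _ _).symm

lemma ι_π (N : ModuleCat.{u} R) : (ι R).app N ≫ (π R).app N = 0 := cokernel.condition _

/-- The short complex `0 ⟶ N ⟶ J N ⟶ Ω N ⟶ 0`, functorially in `N`. -/
def cosyzygySequence : ModuleCat.{u} R ⥤ ShortComplex (ModuleCat.{u} R) where
  obj N := ShortComplex.mk ((ι R).app N) ((π R).app N) (ι_π R N)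
  map f :=
    { τ₁ := f
      τ₂ := (J R).map f
      τ₃ := (Ω R).map f
      comm₁₂ := (ι R).naturality f
      comm₂₃ := (π R).naturality f }
  map_id N := by ext1 <;> simp
  map_comp f g := by ext1 <;> simp

lemma cosyzygySequence_shortExact (N : ModuleCat.{u} R) :
    ((cosyzygySequence R).obj N).ShortExact where
  exact := ShortComplex.exact_cokernel _
  mono_f := inferInstanceAs (Mono ((ι R).app N))
  epi_g := inferInstanceAs (Epi (cokernel.π ((ι R).app N)))

/-- The `n`-th cosyzygy functor `Ω^n`. -/
def cosyzygy : ℕ → (ModuleCat.{u} R ⥤ ModuleCat.{u} R)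
  | 0 => 𝟭 _
  | n + 1 => cosyzygy n ⋙ Ω R

/-- The composite `J N ⟶ Ω N ⟶ J (Ω N)`. -/
def splice : J R ⟶ Ω R ⋙ J R where
  app N := (π R).app N ≫ (ι R).app ((Ω R).obj N)
  naturality N N' f := by
    have h₁ := (π R).naturality f
    have h₂ := (ι R).naturality ((Ω R).map f)
    simp only [Functor.id_map] at h₂
    rw [reassoc_of% h₁, h₂, Category.assoc, Functor.comp_map]

lemma splice_splice (N : ModuleCat.{u} R) :
    (splice R).app N ≫ (splice R).app ((Ω R).obj N) = 0 := by
  have h := ι_π R ((Ω R).obj N)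
  simp only [splice, Category.assoc]
  rw [reassoc_of% h, zero_comp, comp_zero]

/-- Exactness of `0 ⟶ N ⟶ I^0 ⟶ I^1` (the first map is a monomorphism by the instance above). -/
lemma ι_splice_exact (N : ModuleCat.{u} R) (h : (ι R).app N ≫ (splice R).app N = 0) :
    (ShortComplex.mk ((ι R).app N) ((splice R).app N) h).Exact := by
  rw [ShortComplex.moduleCat_exact_iff]
  intro x hx
  have hi : Function.Injective ((ι R).app ((Ω R).obj N)) :=
    (ModuleCat.mono_iff_injective _).1 inferInstance
  exact (ShortComplex.moduleCat_exact_iff _).1 (cosyzygySequence_shortExact R N).exact x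
    (hi ((hx : (ι R).app ((Ω R).obj N) ((π R).app N x) = 0).trans
      (map_zero ((ι R).app ((Ω R).obj N)).hom).symm))

/-- Exactness of `I^n ⟶ I^(n+1) ⟶ I^(n+2)`. -/
lemma splice_exact (N : ModuleCat.{u} R) :
    (ShortComplex.mk _ _ (splice_splice R N)).Exact := by
  rw [ShortComplex.moduleCat_exact_iff]
  intro x hx
  obtain ⟨y, hy⟩ := (ShortComplex.moduleCat_exact_iff _).1 (ι_splice_exact R ((Ω R).obj N)
    (by simp only [splice]; rw [reassoc_of% ι_π R ((Ω R).obj N), zero_comp])) x hx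
  obtain ⟨z, hz⟩ := (ModuleCat.epi_iff_surjective _).1
    (cosyzygySequence_shortExact R N).epi_g y
  exact ⟨z, (congrArg ((ι R).app ((Ω R).obj N)) hz).trans hy⟩

/-- The differential `I^n = J (Ω^n N) ⟶ J (Ω^(n+1) N) = I^(n+1)`. -/
def resolutionD (n : ℕ) : cosyzygy R n ⋙ J R ⟶ cosyzygy R (n + 1) ⋙ J R :=
  Functor.whiskerLeft (cosyzygy R n) (splice R)

lemma resolutionD_comp (N : ModuleCat.{u} R) (n : ℕ) :
    (resolutionD R n).app N ≫ (resolutionD R (n + 1)).app N = 0 :=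
  splice_splice R ((cosyzygy R n).obj N)

/-- The injective resolution `I` of `N` obtained by splicing the sequences
`0 ⟶ Ω^n N ⟶ J (Ω^n N) ⟶ Ω^(n+1) N ⟶ 0`, functorially in `N`. -/
def resolution : ModuleCat.{u} R ⥤ CochainComplex (ModuleCat.{u} R) ℕ where
  obj N := CochainComplex.of (fun n => (cosyzygy R n ⋙ J R).obj N)
    (fun n => (resolutionD R n).app N)
    (resolutionD_comp R N)
  map f := CochainComplex.ofHom (fun n => (cosyzygy R n ⋙ J R).map f) (fun n => by
    dsimp only [CochainComplex.of]
    rw [CochainComplex.of_d, CochainComplex.of_d]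
    exact (resolutionD R n).naturality f)
  map_id N := by
    ext1 n
    exact (cosyzygy R n ⋙ J R).map_id N
  map_comp f g := by
    ext1 n
    exact (cosyzygy R n ⋙ J R).map_comp f g

end InjectiveResolution

/-! ## Tor -/

section Tor

variable (𝕜 : Type w) {R : Type u} [CommRing 𝕜] [Ring R] [Algebra 𝕜 R]

/-- The complex `P ⊗_R N`, for a complex `P` of right `R`-modules, as a functor of the left
`R`-module `N`. -/
def tensorComplex (P : ChainComplex (ModuleCat.{u} Rᵐᵒᵖ) ℕ) :
    ModuleCat.{u} R ⥤ ChainComplex (ModuleCat.{u} 𝕜) ℕ where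
  obj N :=
    { X := fun n => ModuleCat.of 𝕜 (RTensor 𝕜 R (P.X n) N)
      d := fun i j => ModuleCat.ofHom (RTensor.map 𝕜 (P.d i j).hom LinearMap.id)
      shape := fun i j h => by
        rw [P.shape i j h, ModuleCat.hom_zero, RTensor.map_zero_left, ModuleCat.ofHom_zero]
      d_comp_d' := fun i j k _ _ => by
        rw [← ModuleCat.ofHom_comp, ← RTensor.map_comp, ← ModuleCat.hom_comp, P.d_comp_d,
          ModuleCat.hom_zero, RTensor.map_zero_left, ModuleCat.ofHom_zero] }
  map f :=
    { f := fun n => ModuleCat.ofHom (RTensor.map 𝕜 LinearMap.id f.hom)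
      comm' := fun i j _ => by
        rw [← ModuleCat.ofHom_comp, ← ModuleCat.ofHom_comp]
        exact congrArg ModuleCat.ofHom (RTensor.hom_ext 𝕜 fun _ _ => rfl) }
  map_id N := by
    ext1 n
    exact congrArg ModuleCat.ofHom (RTensor.map_id 𝕜)
  map_comp f g := by
    ext1 n
    exact congrArg ModuleCat.ofHom
      (RTensor.map_comp 𝕜 (LinearMap.id) (LinearMap.id) f.hom g.hom)

instance (P : ChainComplex (ModuleCat.{u} Rᵐᵒᵖ) ℕ) :
    (tensorComplex 𝕜 P).PreservesZeroMorphisms where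
  map_zero X Y := by
    ext1 n
    exact congrArg ModuleCat.ofHom (RTensor.map_zero_right 𝕜 LinearMap.id)

lemma tensorComplex_shortExact (P : ChainComplex (ModuleCat.{u} Rᵐᵒᵖ) ℕ)
    (hP : ∀ n, Projective (P.X n)) (S : ShortComplex (ModuleCat.{u} R)) (hS : S.ShortExact) :
    (S.map (tensorComplex 𝕜 P)).ShortExact := by
  apply HomologicalComplex.shortExact_of_degreewise_shortExact
  intro n
  have : Module.Projective Rᵐᵒᵖ (P.X n) := (IsProjective.iff_projective _).2 (hP n)
  refine ShortComplex.ShortExact.mk' ?_ ?_ ?_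
  · rw [ShortComplex.ShortExact.moduleCat_exact_iff_function_exact]
    exact RTensor.map_exact 𝕜 _ _ ((ShortComplex.ShortExact.moduleCat_exact_iff_function_exact _).1 hS.exact)
  · rw [ModuleCat.mono_iff_injective]
    exact RTensor.map_injective 𝕜 _ hS.moduleCat_injective_f
  · rw [ModuleCat.epi_iff_surjective]
    exact RTensor.map_surjective 𝕜 _ hS.moduleCat_surjective_g

variable (M : ModuleCat.{u} Rᵐᵒᵖ)

/-- The chosen projective resolution of `M`. -/
abbrev projRes : ChainComplex (ModuleCat.{u} Rᵐᵒᵖ) ℕ := (projectiveResolution M).complex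

/-- `Tor_i(M, -)` for `i : ℤ`: the homology of `P ⊗_R -`, which is zero in negative degrees. -/
def Tor : ℤ → (ModuleCat.{u} R ⥤ ModuleCat.{u} 𝕜)
  | .ofNat n => tensorComplex 𝕜 (projRes M) ⋙ HomologicalComplex.homologyFunctor _ _ n
  | .negSucc _ => (Functor.const _).obj (ModuleCat.of 𝕜 PUnit)

/-- The connecting map `Tor_i(M, Ω N) ⟶ Tor_j(M, N)`, `i = j + 1`, of the long exact sequence
associated with `0 ⟶ N ⟶ J N ⟶ Ω N ⟶ 0`. -/
def connecting : ∀ i j : ℤ, j + 1 = i → (Ω R ⋙ Tor 𝕜 M i ⟶ Tor 𝕜 M j)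
  | _, .ofNat n, rfl =>
    { app := fun N => (tensorComplex_shortExact 𝕜 (projRes M) (projectiveResolution M).projective _
        (cosyzygySequence_shortExact R N)).δ (n + 1) n rfl
      naturality := fun N N' f => (HomologicalComplex.HomologySequence.δ_naturality
        ((tensorComplex 𝕜 (projRes M)).mapShortComplex.map ((cosyzygySequence R).map f))
        (tensorComplex_shortExact 𝕜 (projRes M) (projectiveResolution M).projective _
          (cosyzygySequence_shortExact R N))
        (tensorComplex_shortExact 𝕜 (projRes M) (projectiveResolution M).projective _
          (cosyzygySequence_shortExact R N')) (n + 1) n rfl).symm }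
  | _, .negSucc _, _ => { app := fun _ => 0, naturality := by intros; simp }

lemma comp_connecting (i j : ℤ) (h : j + 1 = i) (N : ModuleCat.{u} R) :
    (Tor 𝕜 M i).map ((π R).app N) ≫ (connecting 𝕜 M i j h).app N = 0 := by
  match i, j, h with
  | _, .ofNat n, rfl =>
    exact (tensorComplex_shortExact 𝕜 (projRes M) (projectiveResolution M).projective _
        (cosyzygySequence_shortExact R N)).comp_δ (n + 1) n rfl
  | _, .negSucc _, _ => exact comp_zero

end Tor

/-! ## Satellites and complete homology -/

section Complete

variable {𝕜 : Type w} {R : Type u} [CommRing 𝕜] [Ring R]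

/-- The `n`-th right satellite of a functor `T`: its value at `N` is the cokernel of
`T(I^(n-1)) ⟶ T(Ω^n N)`, where `I^(n-1) = J (Ω^(n-1) N)`; and `S^0 T = T`. -/
def satellite (T : ModuleCat.{u} R ⥤ ModuleCat.{u} 𝕜) :
    ℕ → (ModuleCat.{u} R ⥤ ModuleCat.{u} 𝕜)
  | 0 => T
  | n + 1 =>
    { obj := fun N => cokernel (T.map ((π R).app ((cosyzygy R n).obj N)))
      map := fun f => cokernel.map _ _ (T.map ((J R).map ((cosyzygy R n).map f)))
        (T.map ((Ω R).map ((cosyzygy R n).map f))) (by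
          rw [← T.map_comp, ← T.map_comp, (π R).naturality])
      map_id := fun N => by ext1; simp
      map_comp := fun f g => by
        refine coequalizer.hom_ext ?_
        refine (cokernel.π_desc _ _ _).trans ?_
        refine Eq.trans ?_ (cokernel.π_desc_assoc _ _ _ _).symm
        rw [Functor.map_comp, Functor.map_comp, Functor.map_comp, Category.assoc, Category.assoc]
        exact congrArg _ (cokernel.π_desc _ _ _).symm }

/-- The projection `T(Ω^n N) ⟶ S^n T(N)`. -/
def satelliteProj (T : ModuleCat.{u} R ⥤ ModuleCat.{u} 𝕜) :
    ∀ n, cosyzygy R n ⋙ T ⟶ satellite T n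
  | 0 => T.leftUnitor.hom
  | n + 1 =>
    { app := fun N => cokernel.π (T.map ((π R).app ((cosyzygy R n).obj N)))
      naturality := fun _ _ _ => (cokernel.π_desc _ _ _).symm }

variable [Algebra 𝕜 R]

variable (𝕜) (M : ModuleCat.{u} Rᵐᵒᵖ)

/-- The map `S^(n+1) Tor_i(M, N) ⟶ Tor_j(M, Ω^n N)`, `i = j + 1`, induced by the connecting map
`Tor_i(M, Ω^(n+1) N) ⟶ Tor_j(M, Ω^n N)`. -/
def satelliteConnecting (i j : ℤ) (h : j + 1 = i) (n : ℕ) :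
    satellite (Tor 𝕜 M i) (n + 1) ⟶ cosyzygy R n ⋙ Tor 𝕜 M j where
  app N := cokernel.desc _ ((connecting 𝕜 M i j h).app ((cosyzygy R n).obj N))
    (comp_connecting 𝕜 M i j h _)
  naturality N N' f := by
    refine coequalizer.hom_ext ?_
    refine (cokernel.π_desc_assoc _ _ _ _).trans ?_
    refine (Category.assoc _ _ _).trans ?_
    refine (congrArg _ (cokernel.π_desc _ _ _)).trans ?_
    refine ((connecting 𝕜 M i j h).naturality ((cosyzygy R n).map f)).trans ?_
    exact (cokernel.π_desc_assoc _ _ _ _).symm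

/-- Complete homology `Ťor_i(M, -)`: the limit of the inverse system
`⋯ ⟶ S^(n+1) Tor_(n+1+i)(M, -) ⟶ S^n Tor_(n+i)(M, -) ⟶ ⋯ ⟶ S^0 Tor_i(M, -)`. -/
def completeTor (i : ℤ) : ModuleCat.{u} R ⥤ ModuleCat.{u} 𝕜 :=
  limit (Functor.ofOpSequence (X := fun n : ℕ => satellite (Tor 𝕜 M (n + i)) n)
    (fun n : ℕ => satelliteConnecting 𝕜 M ((n + 1 : ℕ) + i) (n + i) (by push_cast; ring) n ≫
      satelliteProj (Tor 𝕜 M (n + i)) n))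

end Complete

/-! ## Stable homology -/

section Stable

variable (𝕜 : Type w) {R : Type u} [CommRing 𝕜] [Ring R] [Algebra 𝕜 R]

/-- All families with entries in `P_p ⊗_R I^j`, for all `p` and `j`. -/
abbrev Families (P : ChainComplex (ModuleCat.{u} Rᵐᵒᵖ) ℕ) (I : CochainComplex (ModuleCat.{u} R) ℕ) :
    Type u :=
  ∀ p j : ℕ, RTensor 𝕜 R (P.X p) (I.X j)

variable (P : ChainComplex (ModuleCat.{u} Rᵐᵒᵖ) ℕ) (I I' : CochainComplex (ModuleCat.{u} R) ℕ)

/-- The differential extending `p ⊗ i ↦ ∂p ⊗ i + (-1)^|p| p ⊗ ∂i`: the component of `∂x` in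
`P_p ⊗ I^j` comes from the components of `x` in `P_(p+1) ⊗ I^j` and in `P_p ⊗ I^(j-1)`
(for `j = 0` there is no second term, since then `I.d (j - 1) j = I.d 0 0 = 0`). -/
def totalD : Families 𝕜 P I →ₗ[𝕜] Families 𝕜 P I :=
  LinearMap.pi fun p => LinearMap.pi fun j =>
    RTensor.map 𝕜 (P.d (p + 1) p).hom LinearMap.id ∘ₗ LinearMap.proj j ∘ₗ LinearMap.proj (p + 1) +
    (-1 : 𝕜) ^ p • RTensor.map 𝕜 LinearMap.id (I.d (j - 1) j).hom ∘ₗ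
      LinearMap.proj (j - 1) ∘ₗ LinearMap.proj p

lemma totalD_apply (x : Families 𝕜 P I) (p j : ℕ) :
    totalD 𝕜 P I x p j = RTensor.map 𝕜 (P.d (p + 1) p).hom LinearMap.id (x (p + 1) j) +
      (-1 : 𝕜) ^ p • RTensor.map 𝕜 LinearMap.id (I.d (j - 1) j).hom (x p (j - 1)) := rfl

lemma totalD_totalD (x : Families 𝕜 P I) : totalD 𝕜 P I (totalD 𝕜 P I x) = 0 := by
  funext p j
  have h₁ : RTensor.map 𝕜 (P.d (p + 1) p).hom (LinearMap.id (R := R) (M := I.X j)) ∘ₗ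
      RTensor.map 𝕜 (P.d (p + 1 + 1) (p + 1)).hom LinearMap.id = 0 := by
    rw [← RTensor.map_comp, ← ModuleCat.hom_comp, P.d_comp_d, ModuleCat.hom_zero,
      RTensor.map_zero_left]
  have h₂ : RTensor.map 𝕜 (LinearMap.id (R := Rᵐᵒᵖ) (M := P.X p)) (I.d (j - 1) j).hom ∘ₗ
      RTensor.map 𝕜 LinearMap.id (I.d (j - 1 - 1) (j - 1)).hom = 0 := by
    rw [← RTensor.map_comp, ← ModuleCat.hom_comp, I.d_comp_d, ModuleCat.hom_zero,
      RTensor.map_zero_right]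
  have h₃ : RTensor.map 𝕜 (P.d (p + 1) p).hom (LinearMap.id (R := R) (M := I.X j)) ∘ₗ
      RTensor.map 𝕜 LinearMap.id (I.d (j - 1) j).hom =
      RTensor.map 𝕜 LinearMap.id (I.d (j - 1) j).hom ∘ₗ
        RTensor.map 𝕜 (P.d (p + 1) p).hom LinearMap.id := by
    rw [← RTensor.map_comp, ← RTensor.map_comp]; rfl
  have h₁' := LinearMap.congr_fun h₁ (x (p + 1 + 1) j)
  have h₂' := LinearMap.congr_fun h₂ (x p (j - 1 - 1))
  have h₃' := LinearMap.congr_fun h₃ (x (p + 1) (j - 1))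
  simp only [LinearMap.comp_apply, LinearMap.zero_apply] at h₁' h₂' h₃'
  simp only [totalD_apply, map_add, map_smul, map_neg, h₁', h₂', h₃', smul_zero, smul_add,
    Pi.zero_apply, pow_succ, mul_neg, mul_one, neg_smul]
  abel

/-- The chain complex with terms the submodules `G n` of `V`, and differential restricted
from `D`. -/
def gradedComplex {V : Type u} [AddCommGroup V] [Module 𝕜 V] (D : V →ₗ[𝕜] V)
    (hD : ∀ x, D (D x) = 0) (G : ℤ → Submodule 𝕜 V)
    (hG : ∀ i j : ℤ, j + 1 = i → ∀ x ∈ G i, D x ∈ G j) : ChainComplex (ModuleCat.{u} 𝕜) ℤ where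
  X n := ModuleCat.of 𝕜 (G n)
  d i j := if h : j + 1 = i then ModuleCat.ofHom (D.restrict (hG i j h)) else 0
  shape i j h := dif_neg h
  d_comp_d' i j k hij hjk := by
    have hij' : j + 1 = i := hij
    have hjk' : k + 1 = j := hjk
    rw [dif_pos hij', dif_pos hjk']
    ext x
    exact hD x.1

/-- The map of complexes induced by a linear map respecting the differentials and the grading. -/
def gradedComplexMap {V V' : Type u} [AddCommGroup V] [Module 𝕜 V] [AddCommGroup V'] [Module 𝕜 V']
    {D : V →ₗ[𝕜] V} {hD : ∀ x, D (D x) = 0} {G : ℤ → Submodule 𝕜 V}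
    {hG : ∀ i j : ℤ, j + 1 = i → ∀ x ∈ G i, D x ∈ G j}
    {D' : V' →ₗ[𝕜] V'} {hD' : ∀ x, D' (D' x) = 0} {G' : ℤ → Submodule 𝕜 V'}
    {hG' : ∀ i j : ℤ, j + 1 = i → ∀ x ∈ G' i, D' x ∈ G' j}
    (f : V →ₗ[𝕜] V') (hf : ∀ x, f (D x) = D' (f x)) (hfG : ∀ n, ∀ x ∈ G n, f x ∈ G' n) :
    gradedComplex 𝕜 D hD G hG ⟶ gradedComplex 𝕜 D' hD' G' hG' where
  f n := ModuleCat.ofHom (f.restrict (hfG n))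
  comm' i j hij := by
    have hij' : j + 1 = i := hij
    simp only [gradedComplex, dif_pos hij']
    ext x
    exact (hf x.1).symm

/-- The families of homological degree `n`: those supported on `P_p ⊗ I^j` with `p - j = n`.
This is the product over `j` of the modules `P_(j+n) ⊗ I^j`. -/
def homogeneous (n : ℤ) : Submodule 𝕜 (Families 𝕜 P I) where
  carrier := {x | ∀ p j : ℕ, (p : ℤ) - j ≠ n → x p j = 0}
  zero_mem' _ _ _ := rfl
  add_mem' hx hy p j h := by simp [hx p j h, hy p j h]
  smul_mem' c x hx p j h := by simp [hx p j h]

/-- The families of homological degree `n` with finite support. This is the direct sum over `j`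
of the modules `P_(j+n) ⊗ I^j`. -/
def finitelySupported (n : ℤ) : Submodule 𝕜 (Families 𝕜 P I) where
  carrier := {x | x ∈ homogeneous 𝕜 P I n ∧ {q : ℕ × ℕ | x q.1 q.2 ≠ 0}.Finite}
  zero_mem' := ⟨Submodule.zero_mem _, by simp⟩
  add_mem' := fun {x y} hx hy => ⟨Submodule.add_mem _ hx.1 hy.1,
    (hx.2.union hy.2).subset fun q hq => by
      by_contra h
      simp only [Set.mem_union, Set.mem_ofPred_eq, not_or, not_not] at h
      exact hq (by simp [h.1, h.2])⟩
  smul_mem' := fun c x hx => ⟨Submodule.smul_mem _ c hx.1, hx.2.subset fun q hq h => hq (by simp [h])⟩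

lemma totalD_homogeneous (i j : ℤ) (h : j + 1 = i) (x : Families 𝕜 P I)
    (hx : x ∈ homogeneous 𝕜 P I i) : totalD 𝕜 P I x ∈ homogeneous 𝕜 P I j := by
  intro p q hpq
  rw [totalD_apply, hx (p + 1) q (by push_cast; omega), map_zero, zero_add]
  cases q with
  | zero => rw [I.shape _ _ (by simp), ModuleCat.hom_zero, RTensor.map_zero_right,
      LinearMap.zero_apply, smul_zero]
  | succ q => rw [hx p (q + 1 - 1) (by push_cast at hpq; simp; omega), map_zero, smul_zero]

lemma totalD_finitelySupported (i j : ℤ) (h : j + 1 = i) (x : Families 𝕜 P I)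
    (hx : x ∈ finitelySupported 𝕜 P I i) : totalD 𝕜 P I x ∈ finitelySupported 𝕜 P I j := by
  refine ⟨totalD_homogeneous 𝕜 P I i j h x hx.1, ?_⟩
  refine ((hx.2.image fun q => (q.1 - 1, q.2)).union (hx.2.image fun q => (q.1, q.2 + 1))).subset ?_
  rintro ⟨p, q⟩ hq
  simp only [Set.mem_ofPred_eq, totalD_apply] at hq
  by_cases h₁ : x (p + 1) q = 0
  · rw [h₁, map_zero, zero_add] at hq
    cases q with
    | zero =>
      rw [I.shape _ _ (by simp), ModuleCat.hom_zero, RTensor.map_zero_right,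
        LinearMap.zero_apply, smul_zero] at hq
      exact absurd rfl hq
    | succ q =>
      refine Or.inr ⟨(p, q), fun h₂ => hq ?_, rfl⟩
      have h₂' : x p (q + 1 - 1) = 0 := h₂
      rw [h₂', map_zero, smul_zero]
  · exact Or.inl ⟨(p + 1, q), h₁, rfl⟩

/-- The tensor product complex `P ⊗_R I`, with components the direct sums of the
`P_(j+n) ⊗ I^j`. -/
def tensor : ChainComplex (ModuleCat.{u} 𝕜) ℤ :=
  gradedComplex 𝕜 (totalD 𝕜 P I) (totalD_totalD 𝕜 P I) (finitelySupported 𝕜 P I)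
    (totalD_finitelySupported 𝕜 P I)

/-- The completed tensor product complex, with components the products of the
`P_(j+n) ⊗ I^j`. -/
def barTensor : ChainComplex (ModuleCat.{u} 𝕜) ℤ :=
  gradedComplex 𝕜 (totalD 𝕜 P I) (totalD_totalD 𝕜 P I) (homogeneous 𝕜 P I)
    (totalD_homogeneous 𝕜 P I)

/-- The inclusion of the tensor product complex in the completed one. -/
def tensorInclusion : tensor 𝕜 P I ⟶ barTensor 𝕜 P I :=
  gradedComplexMap 𝕜 LinearMap.id (fun _ => rfl) fun _ _ h => h.1

variable {I I'}

/-- The map of families induced by a map of complexes. -/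
def familiesMap (f : I ⟶ I') : Families 𝕜 P I →ₗ[𝕜] Families 𝕜 P I' :=
  LinearMap.pi fun p => LinearMap.pi fun j =>
    RTensor.map 𝕜 LinearMap.id (f.f j).hom ∘ₗ LinearMap.proj j ∘ₗ LinearMap.proj p

lemma familiesMap_apply (f : I ⟶ I') (x : Families 𝕜 P I) (p j : ℕ) :
    familiesMap 𝕜 P f x p j = RTensor.map 𝕜 LinearMap.id (f.f j).hom (x p j) := rfl

lemma familiesMap_totalD (f : I ⟶ I') (x : Families 𝕜 P I) :
    familiesMap 𝕜 P f (totalD 𝕜 P I x) = totalD 𝕜 P I' (familiesMap 𝕜 P f x) := by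
  funext p j
  simp only [familiesMap_apply, totalD_apply, map_add, map_smul, ← LinearMap.comp_apply,
    ← RTensor.map_comp, ← ModuleCat.hom_comp, f.comm, LinearMap.id_comp, LinearMap.comp_id]

lemma familiesMap_homogeneous (f : I ⟶ I') (n : ℤ) (x : Families 𝕜 P I)
    (hx : x ∈ homogeneous 𝕜 P I n) : familiesMap 𝕜 P f x ∈ homogeneous 𝕜 P I' n :=
  fun p j h => by rw [familiesMap_apply, hx p j h, map_zero]

lemma familiesMap_finitelySupported (f : I ⟶ I') (n : ℤ) (x : Families 𝕜 P I)
    (hx : x ∈ finitelySupported 𝕜 P I n) : familiesMap 𝕜 P f x ∈ finitelySupported 𝕜 P I' n :=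
  ⟨familiesMap_homogeneous 𝕜 P f n x hx.1, hx.2.subset fun q hq h => hq (by
    rw [familiesMap_apply, h, map_zero])⟩

/-- The map of tensor product complexes induced by a map of complexes. -/
def tensorMap (f : I ⟶ I') : tensor 𝕜 P I ⟶ tensor 𝕜 P I' :=
  gradedComplexMap 𝕜 (familiesMap 𝕜 P f) (familiesMap_totalD 𝕜 P f)
    (familiesMap_finitelySupported 𝕜 P f)

/-- The map of completed tensor product complexes induced by a map of complexes. -/
def barTensorMap (f : I ⟶ I') : barTensor 𝕜 P I ⟶ barTensor 𝕜 P I' :=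
  gradedComplexMap 𝕜 (familiesMap 𝕜 P f) (familiesMap_totalD 𝕜 P f)
    (familiesMap_homogeneous 𝕜 P f)

lemma familiesMap_id (x : Families 𝕜 P I) : familiesMap 𝕜 P (𝟙 I) x = x := by
  funext p j
  exact LinearMap.congr_fun (RTensor.map_id 𝕜) (x p j)

lemma familiesMap_comp {I'' : CochainComplex (ModuleCat.{u} R) ℕ} (f : I ⟶ I') (g : I' ⟶ I'')
    (x : Families 𝕜 P I) :
    familiesMap 𝕜 P (f ≫ g) x = familiesMap 𝕜 P g (familiesMap 𝕜 P f x) := by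
  funext p j
  exact LinearMap.congr_fun
    (RTensor.map_comp 𝕜 LinearMap.id LinearMap.id (f.f j).hom (g.f j).hom) (x p j)

lemma barTensorMap_id : barTensorMap 𝕜 P (𝟙 I) = 𝟙 _ := by
  ext n x
  exact Subtype.ext (familiesMap_id 𝕜 P x.1)

lemma barTensorMap_comp {I'' : CochainComplex (ModuleCat.{u} R) ℕ} (f : I ⟶ I') (g : I' ⟶ I'') :
    barTensorMap 𝕜 P (f ≫ g) = barTensorMap 𝕜 P f ≫ barTensorMap 𝕜 P g := by
  ext n x
  exact Subtype.ext (familiesMap_comp 𝕜 P f g x.1)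

/-- The quotient of the completed tensor product complex by the tensor product complex, as a
functor of `I`. -/
def stableTensor :
    CochainComplex (ModuleCat.{u} R) ℕ ⥤ ChainComplex (ModuleCat.{u} 𝕜) ℤ where
  obj I := cokernel (tensorInclusion 𝕜 P I)
  map f := cokernel.map _ _ (tensorMap 𝕜 P f) (barTensorMap 𝕜 P f) rfl
  map_id I := by
    refine coequalizer.hom_ext ?_
    refine (cokernel.π_desc _ _ _).trans ?_
    rw [barTensorMap_id]
    exact (Category.id_comp _).trans (Category.comp_id _).symm
  map_comp f g := by
    refine coequalizer.hom_ext ?_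
    refine (cokernel.π_desc _ _ _).trans ?_
    rw [barTensorMap_comp, Category.assoc]
    refine Eq.trans ?_ (cokernel.π_desc_assoc _ _ _ _).symm
    rw [Category.assoc]
    exact congrArg _ (cokernel.π_desc _ _ _).symm

/-- Stable homology: the homology in degree `i + 1` of the quotient of the completed tensor product
complex of `P` and `I` by their tensor product complex, where `P` is a projective resolution of `M`
and `I` is an injective resolution of the argument. -/
def stableTor (M : ModuleCat.{u} Rᵐᵒᵖ) (i : ℤ) : ModuleCat.{u} R ⥤ ModuleCat.{u} 𝕜 :=
  resolution R ⋙ stableTensor 𝕜 (projRes M) ⋙ HomologicalComplex.homologyFunctor _ _ (i + 1)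

end Stable


end

end CompleteHomology

/-! Both theories are compared with `Tor_{k+i}(M, Ω^k -)` for one large `k`; the hypotheses on `M`
serve only to produce a bound `n` such that `Tor_m(M, J) = 0` for every injective `J` and every `m >
n`.

The bound comes from duality. For `F` finitely generated free, `F ⊗ J` is the module of `R`-linear
maps from the dual `F^*` to `J`. If `M` is resolved by such modules, the vanishing of `Ext^m(M, R)`
says that the dual complex is exact in degree `m`, and mapping into an injective `J` preserves this
exactness (`RTensor.exact_of_dual_exact`). Homotopy invariance carries the result over to the chosen
resolution `P`.

On the complete side, dimension shifting along `0 → Ω^k N → I^k → Ω^{k+1} N → 0` makes all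
transition maps of the tower isomorphisms once `k + i > n`, and the satellites there coincide with
the functors themselves. So the limit is `Tor_{k+i}(M, Ω^k -)` (`nonempty_completeTor_iso`).

On the stable side, `I` may be replaced by its tail `I^{≥k}`: in each degree only finitely many
terms have `j < k`, so the quotient of product by sum does not change (`tailSequence_shortExact`).
In degree `m` the completed tail involves only `P_p` with `p ≥ m + k`, so if `n < m + k` its columns
are exact where needed, and a cycle can be bounded column by column. This may take infinitely many
steps, which products allow (`isZero_homology_barTensorTail`). Hence stable homology in degree `i`
is `H_i(P ⊗ I^{≥k})`. Finally `I^{≥k}` is a shifted resolution of `Ω^k N` and each `P_p` is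
projective, so an elimination from the last nonzero column downwards, finite because sums are used
here, identifies this homology with `Tor_{k+i}(M, Ω^k N)` (`eq_single_add_totalD`). -/

namespace CompleteHomology

noncomputable section

/-! ### Duality between tensor products with finitely generated free modules and linear maps on
their duals. -/

section Contraction

variable (𝕜 : Type w) {R : Type u} [CommRing 𝕜] [Ring R] [Algebra 𝕜 R]

namespace RTensor

section

variable {F F' J : Type u} [AddCommGroup F] [Module Rᵐᵒᵖ F] [AddCommGroup F'] [Module Rᵐᵒᵖ F']
  [AddCommGroup J] [Module R J]

/-- The additive map `F ⊗_R J → J` given by a linear form on `F`. -/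
def contract (g : F →ₗ[Rᵐᵒᵖ] R) : RTensor 𝕜 R F J →+ J :=
  liftAdd 𝕜 (AddMonoidHom.mk' (fun m => AddMonoidHom.mk' (fun x => g m • x)
      (fun a b => smul_add _ a b))
      (fun a b => by ext x; simp [add_smul]))
    (fun m r x => by simp [mul_smul])

@[simp] lemma contract_tmul (g : F →ₗ[Rᵐᵒᵖ] R) (m : F) (x : J) :
    contract 𝕜 g (tmul 𝕜 R m x) = g m • x := rfl

lemma contract_map (g : F' →ₗ[Rᵐᵒᵖ] R) (u : F →ₗ[Rᵐᵒᵖ] F') (x : RTensor 𝕜 R F J) :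
    contract 𝕜 g (map 𝕜 u LinearMap.id x) = contract 𝕜 (g ∘ₗ u) x := by
  induction x using induction_on with
  | zero => simp
  | tmul m n => rfl
  | add x y hx hy => rw [map_add, map_add, hx, hy, map_add]

/-- The map from `F ⊗_R J` to the `J`-valued linear maps on the dual of `F`. -/
def toDualHom (x : RTensor 𝕜 R F J) : (F →ₗ[Rᵐᵒᵖ] R) →ₗ[R] J where
  toFun g := contract 𝕜 g x
  map_add' g h := by
    induction x using induction_on with
    | zero => simp
    | tmul m n => simp [add_smul]
    | add x y hx hy => rw [map_add, map_add, map_add, hx, hy]; abel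
  map_smul' r g := by
    induction x using induction_on with
    | zero => simp
    | tmul m n => simp [mul_smul]
    | add x y hx hy => rw [map_add, map_add, hx, hy, smul_add]

lemma toDualHom_apply (x : RTensor 𝕜 R F J) (g : F →ₗ[Rᵐᵒᵖ] R) :
    toDualHom 𝕜 x g = contract 𝕜 g x := rfl

end

variable {J : Type u} [AddCommGroup J] [Module R J] {ι : Type} [Fintype ι] [DecidableEq ι]

variable (R) in
/-- A coordinate of a free right module, as a linear form. -/
def coordForm (i : ι) : (ι → Rᵐᵒᵖ) →ₗ[Rᵐᵒᵖ] R where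
  toFun m := (m i).unop
  map_add' _ _ := rfl
  map_smul' _ _ := rfl

/-- The element of `R^ι ⊗_R J` corresponding to a `J`-valued linear map on the dual. -/
def ofDualHom (ψ : ((ι → Rᵐᵒᵖ) →ₗ[Rᵐᵒᵖ] R) →ₗ[R] J) : RTensor 𝕜 R (ι → Rᵐᵒᵖ) J :=
  ∑ i, tmul 𝕜 R (Pi.single i 1) (ψ (coordForm R i))

lemma sum_smul_coordForm (g : (ι → Rᵐᵒᵖ) →ₗ[Rᵐᵒᵖ] R) :
    ∑ i, g (Pi.single i 1) • coordForm R i = g := by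
  refine LinearMap.ext fun m => ?_
  conv_rhs => rw [pi_eq_sum_univ' m, map_sum]
  rw [LinearMap.sum_apply]
  refine Finset.sum_congr rfl fun i _ => ?_
  rw [map_smul]
  simp [coordForm]

lemma toDualHom_ofDualHom (ψ : ((ι → Rᵐᵒᵖ) →ₗ[Rᵐᵒᵖ] R) →ₗ[R] J) :
    toDualHom 𝕜 (ofDualHom 𝕜 ψ) = ψ := by
  refine LinearMap.ext fun g => ?_
  conv_rhs => rw [← sum_smul_coordForm g, map_sum]
  rw [toDualHom_apply, ofDualHom, map_sum]
  exact Finset.sum_congr rfl fun i _ => by simp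

/-- Moving the coordinates of `m` across the tensor sign turns the sum into the expansion of `m` in
the standard basis. This makes `toDualHom` bijective, so elements of the tensor product can be
tested and constructed through the dual. -/
lemma ofDualHom_toDualHom (x : RTensor 𝕜 R (ι → Rᵐᵒᵖ) J) :
    ofDualHom 𝕜 (toDualHom 𝕜 x) = x := by
  simp only [ofDualHom, toDualHom_apply]
  induction x using induction_on with
  | zero => simp
  | tmul m n =>
    have h (i : ι) : tmul 𝕜 R (Pi.single i 1) (contract 𝕜 (coordForm R i) (tmul 𝕜 R m n)) =
        tmul 𝕜 R (Pi.single i (m i) : ι → Rᵐᵒᵖ) n := by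
      rw [contract_tmul, ← op_smul_tmul]
      congr 1
      ext j
      simp only [Pi.smul_apply, Pi.single_apply, coordForm]
      split <;> simp
    rw [Finset.sum_congr rfl fun i _ => h i]
    conv_rhs => rw [← Finset.univ_sum_single m]
    exact (map_sum (AddMonoidHom.mk' (fun m => tmul 𝕜 R m n)
      (fun a b => add_tmul 𝕜 a b n)) _ _).symm
  | add x y hx hy =>
    conv_rhs => rw [← hx, ← hy]
    simp only [map_add, tmul_add, Finset.sum_add_distrib]

lemma toDualHom_injective :
    Function.Injective (toDualHom 𝕜 : RTensor 𝕜 R (ι → Rᵐᵒᵖ) J → _) :=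
  Function.LeftInverse.injective (ofDualHom_toDualHom 𝕜)

/-- If dualizing `R^κ → R^ι → X` gives an exact sequence, then so does tensoring it with an
injective module. -/
lemma exact_of_dual_exact {κ : Type} [Fintype κ] [DecidableEq κ] [Module.Injective R J]
    {X : Type u} [AddCommGroup X] [Module Rᵐᵒᵖ X]
    (f : (κ → Rᵐᵒᵖ) →ₗ[Rᵐᵒᵖ] (ι → Rᵐᵒᵖ)) (v : (ι → Rᵐᵒᵖ) →ₗ[Rᵐᵒᵖ] X)
    (H : ∀ g : (ι → Rᵐᵒᵖ) →ₗ[Rᵐᵒᵖ] R, g ∘ₗ f = 0 → ∃ h : X →ₗ[Rᵐᵒᵖ] R, h ∘ₗ v = g)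
    (x : RTensor 𝕜 R (ι → Rᵐᵒᵖ) J) (hx : map 𝕜 v LinearMap.id x = 0) :
    ∃ y : RTensor 𝕜 R (κ → Rᵐᵒᵖ) J, map 𝕜 f LinearMap.id y = x := by
  let fd : ((ι → Rᵐᵒᵖ) →ₗ[Rᵐᵒᵖ] R) →ₗ[R] ((κ → Rᵐᵒᵖ) →ₗ[Rᵐᵒᵖ] R) :=
    { toFun := fun g => g ∘ₗ f
      map_add' := fun _ _ => rfl
      map_smul' := fun _ _ => rfl }
  -- A form killed by `f` factors through `v`, so contracting `x` with it passes through the image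
  -- of `x` under `v ⊗ 1`, which is zero.
  have hker : LinearMap.ker fd ≤ LinearMap.ker (toDualHom 𝕜 x) := by
    intro g hg
    obtain ⟨h, rfl⟩ := H g hg
    rw [LinearMap.mem_ker, toDualHom_apply, ← contract_map, hx, map_zero]
  -- By `hker` the map attached to `x` descends to the quotient by `ker fd`, which embeds in the
  -- dual of `R^κ`. Injectivity of `J` extends it to that whole dual, and the extension `ψ` encodes
  -- the required `y`.
  obtain ⟨ψ, hψ⟩ := Module.Injective.out ((LinearMap.ker fd).liftQ fd le_rfl)
    (LinearMap.ker_eq_bot.1 (Submodule.ker_liftQ_eq_bot' _ _ rfl))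
    ((LinearMap.ker fd).liftQ _ hker)
  refine ⟨ofDualHom 𝕜 ψ, toDualHom_injective 𝕜 (LinearMap.ext fun g => ?_)⟩
  rw [toDualHom_apply, contract_map, ← toDualHom_apply, toDualHom_ofDualHom]
  exact hψ (Submodule.Quotient.mk g)

end RTensor

end Contraction

/-! ### Resolutions by finitely generated free modules -/

section FreeResolution

variable {S : Type u} [Ring S]

/-- The number of generators of a chosen finite generating set. -/
def coverRank (Q : {Q : ModuleCat.{u} S // Module.Finite S Q}) : ℕ :=
  haveI := Q.2
  (Module.Finite.exists_fin' S Q.1).choose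

/-- A finitely generated free module mapping onto a given finitely generated one. -/
abbrev cover (Q : {Q : ModuleCat.{u} S // Module.Finite S Q}) : ModuleCat.{u} S :=
  ModuleCat.of S (Fin (coverRank Q) → S)

/-- The projection of the cover. -/
def coverMap (Q : {Q : ModuleCat.{u} S // Module.Finite S Q}) : cover Q ⟶ Q.1 :=
  haveI := Q.2
  ModuleCat.ofHom (Module.Finite.exists_fin' S Q.1).choose_spec.choose

lemma coverMap_surjective (Q : {Q : ModuleCat.{u} S // Module.Finite S Q}) :
    Function.Surjective (coverMap Q) :=
  haveI := Q.2
  (Module.Finite.exists_fin' S Q.1).choose_spec.choose_spec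

variable [IsNoetherianRing S]

/-- The syzygies of a finitely generated module over a noetherian ring. -/
def syzygy (M : {Q : ModuleCat.{u} S // Module.Finite S Q}) :
    ℕ → {Q : ModuleCat.{u} S // Module.Finite S Q}
  | 0 => M
  | n + 1 => ⟨ModuleCat.of S (LinearMap.ker (coverMap (syzygy M n)).hom),
      inferInstanceAs (Module.Finite S (LinearMap.ker (coverMap (syzygy M n)).hom))⟩

/-- The embedding of the syzygies. -/
def syzygyι (M : {Q : ModuleCat.{u} S // Module.Finite S Q}) (n : ℕ) :
    (syzygy M (n + 1)).1 ⟶ cover (syzygy M n) :=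
  ModuleCat.ofHom (LinearMap.ker (coverMap (syzygy M n)).hom).subtype

lemma syzygyι_injective (M : {Q : ModuleCat.{u} S // Module.Finite S Q}) (n : ℕ) :
    Function.Injective (syzygyι M n) :=
  Subtype.val_injective

lemma exists_syzygyι (M : {Q : ModuleCat.{u} S // Module.Finite S Q}) (n : ℕ)
    (x : cover (syzygy M n)) (hx : coverMap (syzygy M n) x = 0) :
    ∃ y, syzygyι M n y = x :=
  ⟨⟨x, hx⟩, rfl⟩

lemma syzygyι_coverMap (M : {Q : ModuleCat.{u} S // Module.Finite S Q}) (n : ℕ) :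
    syzygyι M n ≫ coverMap (syzygy M n) = 0 := by
  ext x
  exact x.2

/-- The complex of finitely generated free modules resolving a module. -/
def freeComplex (M : {Q : ModuleCat.{u} S // Module.Finite S Q}) :
    ChainComplex (ModuleCat.{u} S) ℕ :=
  ChainComplex.of (fun n => cover (syzygy M n))
    (fun n => coverMap (syzygy M (n + 1)) ≫ syzygyι M n)
    (fun n => by
      rw [Category.assoc, reassoc_of% (syzygyι_coverMap M (n + 1)), zero_comp, comp_zero])

lemma freeComplex_d (M : {Q : ModuleCat.{u} S // Module.Finite S Q}) (n : ℕ) :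
    (freeComplex M).d (n + 1) n = coverMap (syzygy M (n + 1)) ≫ syzygyι M n := by
  dsimp only [freeComplex, ChainComplex.of]
  exact ChainComplex.of_d _ _ _

lemma freeComplex_d_coverMap (M : {Q : ModuleCat.{u} S // Module.Finite S Q}) :
    (freeComplex M).d 1 0 ≫ (show (freeComplex M).X 0 ⟶ M.1 from coverMap M) = 0 := by
  refine (congrArg (· ≫ coverMap M) (freeComplex_d M 0)).trans ?_
  refine (Category.assoc _ _ _).trans ?_
  exact (congrArg _ (syzygyι_coverMap M 0)).trans comp_zero

lemma freeComplex_exactAt_succ (M : {Q : ModuleCat.{u} S // Module.Finite S Q}) (n : ℕ) :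
    (freeComplex M).ExactAt (n + 1) := by
  rw [HomologicalComplex.exactAt_iff' _ (n + 1 + 1) (n + 1) n (by simp) (by simp),
    ShortComplex.moduleCat_exact_iff]
  intro x hx
  change (freeComplex M).d (n + 1) n x = 0 at hx
  change ∃ y, (freeComplex M).d (n + 1 + 1) (n + 1) y = x
  rw [freeComplex_d] at hx ⊢
  have h : coverMap (syzygy M (n + 1)) x = 0 :=
    syzygyι_injective M n (hx.trans (map_zero (syzygyι M n).hom).symm)
  obtain ⟨y, hy⟩ := exists_syzygyι M (n + 1) x h
  obtain ⟨z, rfl⟩ := coverMap_surjective _ y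
  exact ⟨z, hy⟩

/-- A resolution of a finitely generated module by finitely generated free modules. -/
def freeResolution (M : {Q : ModuleCat.{u} S // Module.Finite S Q}) :
    ProjectiveResolution M.1 where
  complex := freeComplex M
  projective n := (IsProjective.iff_projective (cover (syzygy M n))).1 inferInstance
  π := (ChainComplex.toSingle₀Equiv _ _).symm ⟨coverMap M, freeComplex_d_coverMap M⟩
  quasiIso := ⟨fun n => by
    cases n
    -- In degree 0 the condition amounts to exactness of `F_1 → F_0 → M → 0`; in positive degrees,
    -- to exactness of the complex itself.
    · rw [ChainComplex.quasiIsoAt₀_iff, ShortComplex.quasiIso_iff_of_zeros']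
      · have hex : (ShortComplex.mk ((freeComplex M).d 1 0) (coverMap M) (freeComplex_d_coverMap M)).Exact := by
          rw [ShortComplex.moduleCat_exact_iff]
          intro x hx
          change ∃ y, (freeComplex M).d 1 0 y = x
          rw [freeComplex_d]
          obtain ⟨y, hy⟩ := exists_syzygyι M 0 x hx
          obtain ⟨z, rfl⟩ := coverMap_surjective _ y
          exact ⟨z, hy⟩
        refine (ShortComplex.exact_and_epi_g_iff_of_iso ?_).2
          ⟨hex, (ModuleCat.epi_iff_surjective _).2 (coverMap_surjective M)⟩
        have e := ChainComplex.toSingle₀Equiv_symm_apply_f_zero _ (freeComplex_d_coverMap M)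
        refine ShortComplex.isoMk (Iso.refl _) (Iso.refl _) (Iso.refl _)
          ((Category.id_comp _).trans (Category.comp_id _).symm) ?_
        exact (Category.id_comp _).trans (e.symm.trans (Category.comp_id _).symm)
      all_goals rfl
    · rw [quasiIsoAt_iff_exactAt']
      · apply freeComplex_exactAt_succ
      · apply ChainComplex.exactAt_succ_single_obj⟩

end FreeResolution

/-! ### Vanishing of `Tor` on injectives, and stabilization of the tower defining complete homology.
-/

section Vanishing

variable (𝕜 : Type w) {R : Type u} [CommRing 𝕜] [Ring R] [Algebra 𝕜 R]

namespace RTensor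

lemma map_add_left {F F' N N' : Type u} [AddCommGroup F] [Module Rᵐᵒᵖ F] [AddCommGroup F']
    [Module Rᵐᵒᵖ F'] [AddCommGroup N] [Module R N] [AddCommGroup N'] [Module R N']
    (f g : F →ₗ[Rᵐᵒᵖ] F') (h : N →ₗ[R] N') :
    map 𝕜 (f + g) h = map 𝕜 f h + map 𝕜 g h :=
  hom_ext 𝕜 fun m n => by simp [add_tmul]

end RTensor

/-- Exactness of `P ⊗_R N` in degree `m + 1`. -/
def TensorExactAt (P : ChainComplex (ModuleCat.{u} Rᵐᵒᵖ) ℕ) (N : Type u) [AddCommGroup N]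
    [Module R N] (m : ℕ) : Prop :=
  ∀ x : RTensor 𝕜 R (P.X (m + 1)) N, RTensor.map 𝕜 (P.d (m + 1) m).hom LinearMap.id x = 0 →
    ∃ y, RTensor.map 𝕜 (P.d (m + 1 + 1) (m + 1)).hom LinearMap.id y = x

variable {𝕜}

/-- Tensoring the homotopy between `inv ∘ hom` and the identity gives, for a cycle `x`, `inv (hom x)
= d (h x) + x`. If `hom x = d y`, then `x` is the boundary of `inv y - h x`. -/
lemma TensorExactAt.of_homotopyEquiv {P Q : ChainComplex (ModuleCat.{u} Rᵐᵒᵖ) ℕ}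
    (e : HomotopyEquiv P Q) {N : Type u} [AddCommGroup N] [Module R N] {m : ℕ}
    (h : TensorExactAt 𝕜 Q N m) : TensorExactAt 𝕜 P N m := by
  intro x hx
  have hcomm (K L : ChainComplex (ModuleCat.{u} Rᵐᵒᵖ) ℕ) (φ : K ⟶ L) (i j : ℕ)
      (x : RTensor 𝕜 R (K.X i) N) :
      RTensor.map 𝕜 (φ.f j).hom LinearMap.id (RTensor.map 𝕜 (K.d i j).hom LinearMap.id x) =
      RTensor.map 𝕜 (L.d i j).hom LinearMap.id (RTensor.map 𝕜 (φ.f i).hom LinearMap.id x) := by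
    simp only [← LinearMap.comp_apply, ← RTensor.map_comp, ← ModuleCat.hom_comp, φ.comm]
  obtain ⟨y, hy⟩ := h (RTensor.map 𝕜 (e.hom.f (m + 1)).hom LinearMap.id x) (by
    rw [← hcomm, hx, map_zero])
  have H := e.homotopyHomInvId.comm (m + 1)
  rw [Homotopy.dNext_succ_chainComplex, Homotopy.prevD_chainComplex] at H
  have H' := congrArg (fun f => RTensor.map 𝕜 f.hom (LinearMap.id (R := R) (M := N)) x) H
  simp only [HomologicalComplex.comp_f, HomologicalComplex.id_f, ModuleCat.hom_add,
    ModuleCat.hom_comp, ModuleCat.hom_id, RTensor.map_add_left, LinearMap.add_apply] at H'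
  have hc {A B C : Type u} [AddCommGroup A] [Module Rᵐᵒᵖ A] [AddCommGroup B] [Module Rᵐᵒᵖ B]
      [AddCommGroup C] [Module Rᵐᵒᵖ C] (f : A →ₗ[Rᵐᵒᵖ] B) (g : B →ₗ[Rᵐᵒᵖ] C)
      (x : RTensor 𝕜 R A N) :
      RTensor.map 𝕜 (g ∘ₗ f) LinearMap.id x =
      RTensor.map 𝕜 g LinearMap.id (RTensor.map 𝕜 f LinearMap.id x) := by
    rw [← LinearMap.comp_apply, ← RTensor.map_comp, LinearMap.id_comp]
  have hid : RTensor.map 𝕜 (LinearMap.id : P.X (m + 1) →ₗ[Rᵐᵒᵖ] P.X (m + 1))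
      (LinearMap.id (R := R) (M := N)) x = x := by
    rw [RTensor.map_id, LinearMap.id_apply]
  rw [hc, hc, hc, hx, map_zero, zero_add, hid, ← hy, hcomm] at H'
  refine ⟨RTensor.map 𝕜 (e.inv.f (m + 1 + 1)).hom LinearMap.id y -
    RTensor.map 𝕜 (e.homotopyHomInvId.hom (m + 1) (m + 1 + 1)).hom LinearMap.id x, ?_⟩
  rw [map_sub, H']
  abel

/-- A form on `F_{m+1}` that kills boundaries is a cocycle. Its class in `Ext^{m+1}(M, R)` vanishes,
so it extends along `F_{m+1} → F_m`; this is the dual exactness needed by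
`RTensor.exact_of_dual_exact`. -/
lemma tensorExactAt_freeComplex [IsNoetherianRing Rᵐᵒᵖ]
    (M : {Q : ModuleCat.{u} Rᵐᵒᵖ // Module.Finite Rᵐᵒᵖ Q}) (m : ℕ)
    (hM : Subsingleton (CategoryTheory.Abelian.Ext M.1 (ModuleCat.of Rᵐᵒᵖ R) (m + 1)))
    (N : Type u) [AddCommGroup N] [Module R N] [Module.Injective R N] :
    TensorExactAt 𝕜 (freeComplex M) N m := by
  refine RTensor.exact_of_dual_exact (ι := Fin (coverRank (syzygy M (m + 1))))
    (κ := Fin (coverRank (syzygy M (m + 1 + 1)))) 𝕜 _ _ fun g hg => ?_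
  obtain ⟨h, hh⟩ := ((freeResolution M).extMk_eq_zero_iff (Y := ModuleCat.of Rᵐᵒᵖ R)
    (ModuleCat.ofHom g) (m + 1 + 1) rfl (ModuleCat.hom_ext hg) m rfl).1 (Subsingleton.elim _ _)
  exact ⟨h.hom, congrArg ModuleCat.Hom.hom hh⟩

/-- The chosen projective resolution need not consist of finitely generated modules, so exactness is
transported from the free one. -/
lemma tensorExactAt_projRes [IsNoetherianRing Rᵐᵒᵖ] (M : ModuleCat.{u} Rᵐᵒᵖ)
    [hfin : Module.Finite Rᵐᵒᵖ M] (m : ℕ)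
    (hM : Subsingleton (CategoryTheory.Abelian.Ext M (ModuleCat.of Rᵐᵒᵖ R) (m + 1)))
    (N : Type u) [AddCommGroup N] [Module R N] [Module.Injective R N] :
    TensorExactAt 𝕜 (projRes M) N m :=
  (tensorExactAt_freeComplex ⟨M, hfin⟩ m hM N).of_homotopyEquiv
    (ProjectiveResolution.homotopyEquiv _ (freeResolution ⟨M, hfin⟩))

/-- The condition that `P ⊗_R N` is exact in large degrees whenever `N` is injective. -/
def InjectiveVanishing (𝕜 : Type w) {R : Type u} [CommRing 𝕜] [Ring R] [Algebra 𝕜 R]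
    (P : ChainComplex (ModuleCat.{u} Rᵐᵒᵖ) ℕ) (n : ℕ) : Prop :=
  ∀ m, n ≤ m → ∀ N : ModuleCat.{u} R, Injective N → TensorExactAt 𝕜 P N m

lemma exists_injectiveVanishing [IsNoetherianRing Rᵐᵒᵖ] (M : ModuleCat.{u} Rᵐᵒᵖ)
    [Module.Finite Rᵐᵒᵖ M] (hM : ∃ n : ℕ, ∀ i : ℕ, n ≤ i →
      Subsingleton (CategoryTheory.Abelian.Ext M (ModuleCat.of Rᵐᵒᵖ R) i)) :
    ∃ n, InjectiveVanishing 𝕜 (R := R) (projRes M) n := by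
  obtain ⟨n, hn⟩ := hM
  refine ⟨n, fun m hm N hN => ?_⟩
  have : Module.Injective R N := Module.injective_module_of_injective_object R N
  exact tensorExactAt_projRes M m (hn _ (by omega)) N

variable (𝕜) in
lemma isZero_Tor {M : ModuleCat.{u} Rᵐᵒᵖ} {n : ℕ}
    (hM : InjectiveVanishing 𝕜 (R := R) (projRes M) n) (i : ℤ) (hi : n < i)
    (N : ModuleCat.{u} R) [Injective N] : IsZero ((Tor 𝕜 M i).obj N) := by
  obtain ⟨m, rfl⟩ : ∃ m : ℕ, i = Int.ofNat (m + 1) := ⟨(i - 1).toNat, by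
    simp only [Int.ofNat_eq_natCast]; omega⟩
  refine ((HomologicalComplex.exactAt_iff' _ (m + 1 + 1) (m + 1) m (by simp) (by simp)).2
    ((ShortComplex.moduleCat_exact_iff _).2 ?_)).isZero_homology
  exact hM m (by simp at hi; omega) N inferInstance

variable (𝕜) in
-- Dimension shifting: `Tor` of the injective middle term vanishes in both degrees `j` and `j + 1`,
-- since both exceed `n`.
lemma isIso_connecting {M : ModuleCat.{u} Rᵐᵒᵖ} {n : ℕ}
    (hM : InjectiveVanishing 𝕜 (R := R) (projRes M) n) (i j : ℤ) (h : j + 1 = i) (hj : n < j)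
    (N : ModuleCat.{u} R) : IsIso ((connecting 𝕜 M i j h).app N) := by
  obtain ⟨m, rfl⟩ : ∃ m : ℕ, j = Int.ofNat m := ⟨j.toNat, by
    simp only [Int.ofNat_eq_natCast]; omega⟩
  subst h
  exact ShortComplex.ShortExact.isIso_δ (tensorComplex_shortExact 𝕜 (projRes M)
      (projectiveResolution M).projective _ (cosyzygySequence_shortExact R N)) (m + 1) m rfl
    (isZero_Tor 𝕜 hM (Int.ofNat (m + 1)) (by simp at hj ⊢; omega) ((J R).obj N))
    (isZero_Tor 𝕜 hM (Int.ofNat m) hj ((J R).obj N))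

variable (𝕜) in
-- The satellite is the cokernel of a map out of `Tor_i(M, I^k) = 0`, so its projection is
-- invertible. Composing that projection with the map in question gives the connecting isomorphism.
lemma isIso_satelliteConnecting {M : ModuleCat.{u} Rᵐᵒᵖ} {n : ℕ}
    (hM : InjectiveVanishing 𝕜 (R := R) (projRes M) n) (i j : ℤ) (h : j + 1 = i) (hj : n < j)
    (k : ℕ) : IsIso (satelliteConnecting 𝕜 M i j h k) := by
  have (N : ModuleCat.{u} R) : IsIso ((satelliteConnecting 𝕜 M i j h k).app N) := by
    have h0 : (Tor 𝕜 M i).map ((π R).app ((cosyzygy R k).obj N)) = 0 :=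
      (isZero_Tor 𝕜 hM i (by omega) _).eq_of_src _ _
    have : IsIso (cokernel.π ((Tor 𝕜 M i).map ((π R).app ((cosyzygy R k).obj N)))) := by
      rw [h0]; infer_instance
    have h1 : cokernel.π ((Tor 𝕜 M i).map ((π R).app ((cosyzygy R k).obj N))) ≫
        (satelliteConnecting 𝕜 M i j h k).app N =
        (connecting 𝕜 M i j h).app ((cosyzygy R k).obj N) := cokernel.π_desc _ _ _
    have h2 := isIso_connecting 𝕜 hM i j h hj ((cosyzygy R k).obj N)
    rw [← h1] at h2
    exact @IsIso.of_isIso_comp_left _ _ _ _ _ _ _ this h2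
  exact NatIso.isIso_of_isIso_app _

variable (𝕜) in
lemma isIso_satelliteProj {M : ModuleCat.{u} Rᵐᵒᵖ} {n : ℕ}
    (hM : InjectiveVanishing 𝕜 (R := R) (projRes M) n) (i : ℤ) (hi : n < i) (k : ℕ) :
    IsIso (satelliteProj (Tor 𝕜 M i : ModuleCat.{u} R ⥤ _) k) := by
  have (N : ModuleCat.{u} R) : IsIso ((satelliteProj (Tor 𝕜 M i) k).app N) := by
    cases k with
    | zero => exact inferInstanceAs (IsIso ((Tor 𝕜 M i).leftUnitor.hom.app N))
    | succ k =>
      have h0 : (Tor 𝕜 M i).map ((π R).app ((cosyzygy R k).obj N)) = 0 :=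
        (isZero_Tor 𝕜 hM i (by omega) _).eq_of_src _ _
      change IsIso (cokernel.π ((Tor 𝕜 M i).map ((π R).app ((cosyzygy R k).obj N))))
      rw [h0]
      infer_instance
  exact NatIso.isIso_of_isIso_app _

variable (𝕜) in
/-- In the tower defining complete homology, all maps in large degrees are isomorphisms. -/
lemma nonempty_completeTor_iso {M : ModuleCat.{u} Rᵐᵒᵖ} {n : ℕ}
    (hM : InjectiveVanishing 𝕜 (R := R) (projRes M) n) (i : ℤ) (k : ℕ) (hk : n < k + i) :
    Nonempty ((completeTor 𝕜 M i : ModuleCat.{u} R ⥤ _) ≅ cosyzygy R k ⋙ Tor 𝕜 M (k + i)) := by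
  let F : ℕᵒᵖ ⥤ (ModuleCat.{u} R ⥤ ModuleCat.{u} 𝕜) := Functor.ofOpSequence (X := fun n : ℕ => satellite (R := R) (Tor 𝕜 M (n + i)) n)
    (fun n : ℕ => satelliteConnecting 𝕜 M ((n + 1 : ℕ) + i) (n + i) (by push_cast; ring) n ≫
      satelliteProj (Tor 𝕜 M (n + i)) n)
  have hstep (m : ℕ) (hm : k ≤ m) : IsIso (F.map (homOfLE m.le_succ).op) := by
    have e := Functor.ofOpSequence_map_homOfLE_succ (X := fun n : ℕ =>
      satellite (R := R) (Tor 𝕜 M (n + i)) n) (fun n : ℕ =>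
      satelliteConnecting 𝕜 M ((n + 1 : ℕ) + i) (n + i) (by push_cast; ring) n ≫
      satelliteProj (Tor 𝕜 M (n + i)) n) m
    have h1 := isIso_satelliteConnecting (R := R) 𝕜 hM ((m + 1 : ℕ) + i) (m + i)
      (by push_cast; ring) (by omega) m
    have h2 := isIso_satelliteProj (R := R) 𝕜 hM (m + i) (by omega) m
    exact e ▸ IsIso.comp_isIso' h1 h2
  -- Eventual constancy concerns all maps down to stage `k`, which are composites of the one-step
  -- maps treated in `hstep`.
  have hmap (d : ℕ) : ∀ f : Opposite.op (k + d) ⟶ Opposite.op k, IsIso (F.map f) := by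
    induction d with
    | zero =>
      intro f
      rw [Subsingleton.elim f (𝟙 _)]
      infer_instance
    | succ d ih =>
      intro f
      rw [Subsingleton.elim f ((homOfLE (k + d).le_succ).op ≫
        (homOfLE (Nat.le_add_right k d)).op), F.map_comp]
      exact IsIso.comp_isIso' (hstep _ (by omega)) (ih _)
  have hF : F.IsEventuallyConstantTo (Opposite.op k) := by
    rintro ⟨j⟩ f
    obtain ⟨d, rfl⟩ := Nat.exists_eq_add_of_le (leOfHom f.unop)
    exact hmap d f
  have h1 : IsIso (limit.π F (Opposite.op k)) := hF.isIso_π_of_isLimit (limit.isLimit F)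
  have h2 := isIso_satelliteProj (R := R) 𝕜 hM (k + i) (by omega) k
  exact ⟨@asIso _ _ _ _ _ h1 ≪≫ (@asIso _ _ _ _ _ h2).symm⟩

end Vanishing

/-! ### Truncating the injective resolution: stable homology as the homology of a tail of `P ⊗_R I`.
-/

section Tails

variable (𝕜 : Type w) {R : Type u} [CommRing 𝕜] [Ring R] [Algebra 𝕜 R]

lemma gradedComplex_d {V : Type u} [AddCommGroup V] [Module 𝕜 V] (D : V →ₗ[𝕜] V)
    (hD : ∀ x, D (D x) = 0) (G : ℤ → Submodule 𝕜 V)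
    (hG : ∀ i j : ℤ, j + 1 = i → ∀ x ∈ G i, D x ∈ G j) (i j : ℤ) (h : j + 1 = i) :
    (gradedComplex 𝕜 D hD G hG).d i j = ModuleCat.ofHom (D.restrict (hG i j h)) :=
  dif_pos h

lemma isZero_homology_gradedComplex {V : Type u} [AddCommGroup V] [Module 𝕜 V] (D : V →ₗ[𝕜] V)
    (hD : ∀ x, D (D x) = 0) (G : ℤ → Submodule 𝕜 V)
    (hG : ∀ i j : ℤ, j + 1 = i → ∀ x ∈ G i, D x ∈ G j) (i : ℤ)
    (h : ∀ x ∈ G i, D x = 0 → ∃ y ∈ G (i + 1), D y = x) :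
    IsZero ((gradedComplex 𝕜 D hD G hG).homology i) := by
  refine ((HomologicalComplex.exactAt_iff' _ (i + 1) i (i - 1) (by simp) (by simp)).2
    ((ShortComplex.moduleCat_exact_iff _).2 ?_)).isZero_homology
  intro x hx
  change (gradedComplex 𝕜 D hD G hG).d i (i - 1) x = 0 at hx
  change ∃ y, (gradedComplex 𝕜 D hD G hG).d (i + 1) i y = x
  rw [gradedComplex_d _ _ _ _ _ _ _ (by ring)] at hx ⊢
  obtain ⟨y, hy, hyx⟩ := h x.1 x.2 (congrArg Subtype.val hx)
  exact ⟨⟨y, hy⟩, Subtype.ext hyx⟩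

variable (P : ChainComplex (ModuleCat.{u} Rᵐᵒᵖ) ℕ) (I I' : CochainComplex (ModuleCat.{u} R) ℕ)
  (k : ℕ)

/-- The families supported on the `P_p ⊗ I^j` with `j ≥ k`. -/
def tail : Submodule 𝕜 (Families 𝕜 P I) where
  carrier := {x | ∀ p j : ℕ, j < k → x p j = 0}
  zero_mem' _ _ _ := rfl
  add_mem' hx hy p j h := by simp [hx p j h, hy p j h]
  smul_mem' c x hx p j h := by simp [hx p j h]

lemma totalD_tail (x : Families 𝕜 P I) (hx : x ∈ tail 𝕜 P I k) :
    totalD 𝕜 P I x ∈ tail 𝕜 P I k := by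
  intro p j h
  rw [totalD_apply, hx _ j h, hx p (j - 1) (by omega), map_zero, map_zero, smul_zero, add_zero]

/-- The subcomplex of `P ⊗_R I` supported in the degrees `j ≥ k` of `I`. -/
def tensorTail : ChainComplex (ModuleCat.{u} 𝕜) ℤ :=
  gradedComplex 𝕜 (totalD 𝕜 P I) (totalD_totalD 𝕜 P I)
    (fun n => finitelySupported 𝕜 P I n ⊓ tail 𝕜 P I k)
    (fun i j h x hx => ⟨totalD_finitelySupported 𝕜 P I i j h x hx.1, totalD_tail 𝕜 P I k x hx.2⟩)

/-- The subcomplex of the completed tensor product supported in the degrees `j ≥ k` of `I`. -/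
def barTensorTail : ChainComplex (ModuleCat.{u} 𝕜) ℤ :=
  gradedComplex 𝕜 (totalD 𝕜 P I) (totalD_totalD 𝕜 P I)
    (fun n => homogeneous 𝕜 P I n ⊓ tail 𝕜 P I k)
    (fun i j h x hx => ⟨totalD_homogeneous 𝕜 P I i j h x hx.1, totalD_tail 𝕜 P I k x hx.2⟩)

/-- The inclusion of the tail of the tensor product in the tail of the completed one. -/
def tensorTailInclusion : tensorTail 𝕜 P I k ⟶ barTensorTail 𝕜 P I k :=
  gradedComplexMap 𝕜 LinearMap.id (fun _ => rfl) fun _ _ h => ⟨h.1.1, h.2⟩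

/-- The inclusion of the tail of the tensor product. -/
def tensorTailToTensor : tensorTail 𝕜 P I k ⟶ tensor 𝕜 P I :=
  gradedComplexMap 𝕜 LinearMap.id (fun _ => rfl) fun _ _ h => h.1

/-- The inclusion of the tail of the completed tensor product. -/
def barTensorTailToBarTensor : barTensorTail 𝕜 P I k ⟶ barTensor 𝕜 P I :=
  gradedComplexMap 𝕜 LinearMap.id (fun _ => rfl) fun _ _ h => h.1

lemma tensorTailInclusion_comp :
    tensorTailInclusion 𝕜 P I k ≫ barTensorTailToBarTensor 𝕜 P I k =
      tensorTailToTensor 𝕜 P I k ≫ tensorInclusion 𝕜 P I := rfl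

variable {I I'}

lemma familiesMap_tail (f : I ⟶ I') (x : Families 𝕜 P I) (hx : x ∈ tail 𝕜 P I k) :
    familiesMap 𝕜 P f x ∈ tail 𝕜 P I' k :=
  fun p j h => by rw [familiesMap_apply, hx p j h, map_zero]

/-- The tail of the tensor product as a functor. -/
def tensorTailFunctor :
    CochainComplex (ModuleCat.{u} R) ℕ ⥤ ChainComplex (ModuleCat.{u} 𝕜) ℤ where
  obj I := tensorTail 𝕜 P I k
  map f := gradedComplexMap 𝕜 (familiesMap 𝕜 P f) (familiesMap_totalD 𝕜 P f)
    fun n x h => ⟨familiesMap_finitelySupported 𝕜 P f n x h.1, familiesMap_tail 𝕜 P k f x h.2⟩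
  map_id I := by
    ext n x
    exact Subtype.ext (familiesMap_id 𝕜 P x.1)
  map_comp f g := by
    ext n x
    exact Subtype.ext (familiesMap_comp 𝕜 P f g x.1)

/-- The map induced on tails of completed tensor products. -/
def barTensorTailMap (f : I ⟶ I') : barTensorTail 𝕜 P I k ⟶ barTensorTail 𝕜 P I' k :=
  gradedComplexMap 𝕜 (familiesMap 𝕜 P f) (familiesMap_totalD 𝕜 P f)
    fun n x h => ⟨familiesMap_homogeneous 𝕜 P f n x h.1, familiesMap_tail 𝕜 P k f x h.2⟩

lemma tensorTailInclusion_comp_cokernel_π :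
    tensorTailInclusion 𝕜 P I k ≫ barTensorTailToBarTensor 𝕜 P I k ≫
      cokernel.π (tensorInclusion 𝕜 P I) = 0 := by
  rw [← Category.assoc, tensorTailInclusion_comp, Category.assoc, cokernel.condition, comp_zero]

variable (I) in
/-- The short exact sequence whose quotient is the complex computing stable homology. -/
def tailSequence : ShortComplex (ChainComplex (ModuleCat.{u} 𝕜) ℤ) where
  X₁ := tensorTail 𝕜 P I k
  X₂ := barTensorTail 𝕜 P I k
  X₃ := (stableTensor 𝕜 P).obj I
  f := tensorTailInclusion 𝕜 P I k
  g := barTensorTailToBarTensor 𝕜 P I k ≫ cokernel.π (tensorInclusion 𝕜 P I)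
  zero := tensorTailInclusion_comp_cokernel_π 𝕜 P k

/-- Functoriality of the sequence of tails. -/
def tailSequenceMap (f : I ⟶ I') : tailSequence 𝕜 P I k ⟶ tailSequence 𝕜 P I' k where
  τ₁ := (tensorTailFunctor 𝕜 P k).map f
  τ₂ := barTensorTailMap 𝕜 P k f
  τ₃ := (stableTensor 𝕜 P).map f
  comm₁₂ := rfl
  comm₂₃ := by
    refine Eq.trans ?_ (Category.assoc _ _ _).symm
    refine Eq.trans ?_ (congrArg _ (cokernel.π_desc _ _ _).symm)
    rfl

lemma cokernel_π_tensorInclusion_eq_zero_iff (n : ℤ) (x : (barTensor 𝕜 P I).X n) :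
    (cokernel.π (tensorInclusion 𝕜 P I)).f n x = 0 ↔ x.1 ∈ finitelySupported 𝕜 P I n := by
  have hex := (HomologicalComplex.exact_iff_degreewise_exact _).1
    (ShortComplex.exact_cokernel (tensorInclusion 𝕜 P I)) n
  rw [ShortComplex.moduleCat_exact_iff] at hex
  constructor
  · intro h
    obtain ⟨y, hy⟩ := hex x h
    exact (congrArg Subtype.val hy) ▸ y.2
  · intro h
    exact congrArg (fun φ : (tensor 𝕜 P I).X n ⟶ _ =>
        φ.hom (⟨x.1, h⟩ : finitelySupported 𝕜 P I n))
      (HomologicalComplex.congr_hom (cokernel.condition (tensorInclusion 𝕜 P I)) n)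

/-- Cutting off the columns `j < k` changes a homogeneous family in at most `k` entries, because `p
= n + j` is determined by `j`. -/
lemma exists_tail_sub_finitelySupported (n : ℤ) (x : Families 𝕜 P I)
    (hx : x ∈ homogeneous 𝕜 P I n) : ∃ y ∈ homogeneous 𝕜 P I n ⊓ tail 𝕜 P I k,
      x - y ∈ finitelySupported 𝕜 P I n := by
  have hy : (fun p j => if j < k then 0 else x p j : Families 𝕜 P I) ∈ homogeneous 𝕜 P I n := by
    intro p j h
    simp [hx p j h]
  refine ⟨_, ⟨hy, fun p j h => if_pos h⟩, Submodule.sub_mem _ hx hy, ?_⟩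
  refine ((Set.finite_Iio k).image fun j : ℕ => ((n + j).toNat, j)).subset ?_
  rintro ⟨p, j⟩ h
  simp only [Set.mem_ofPred_eq, Pi.sub_apply] at h
  by_cases hj : j < k
  · refine ⟨j, hj, ?_⟩
    have : (p : ℤ) - j = n := by
      by_contra h'
      exact h (by simp [hx p j h'])
    simp only [Prod.mk.injEq, and_true]
    omega
  · exact absurd (by simp [hj]) h

variable (I) in
-- Modulo finitely supported families every homogeneous family lies in the tail, and a family of the
-- tail dies in the quotient exactly when it has finite support. So passing to tails leaves the
-- quotient unchanged.
lemma tailSequence_shortExact : (tailSequence 𝕜 P I k).ShortExact := by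
  apply HomologicalComplex.shortExact_of_degreewise_shortExact
  intro n
  have hepi : Function.Surjective ((cokernel.π (tensorInclusion 𝕜 P I)).f n) :=
    (ModuleCat.epi_iff_surjective _).1 inferInstance
  refine ShortComplex.ShortExact.mk' ?_ ?_ ?_
  · rw [ShortComplex.moduleCat_exact_iff]
    intro x hx
    have := (cokernel_π_tensorInclusion_eq_zero_iff 𝕜 P n
      ((barTensorTailToBarTensor 𝕜 P I k).f n x)).1 hx
    exact ⟨⟨x.1, this, x.2.2⟩, rfl⟩
  · rw [ModuleCat.mono_iff_injective]
    intro x y h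
    have h' := congrArg (fun z : ↥(homogeneous 𝕜 P I n ⊓ tail 𝕜 P I k) => z.1) h
    exact Subtype.ext h'
  · rw [ModuleCat.epi_iff_surjective]
    intro c
    obtain ⟨x, rfl⟩ := hepi c
    obtain ⟨y, hy, hxy⟩ := exists_tail_sub_finitelySupported 𝕜 P k n x.1 x.2
    refine ⟨⟨y, hy⟩, ?_⟩
    have := (cokernel_π_tensorInclusion_eq_zero_iff 𝕜 P n
      (x - (barTensorTailToBarTensor 𝕜 P I k).f n ⟨y, hy⟩)).2 hxy
    rw [map_sub, sub_eq_zero] at this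
    exact this.symm

/-! The completed tail is acyclic in the degrees in which the columns are exact. -/

open Classical in
/-- A chosen preimage under `∂ ⊗ 1`, where it exists. -/
def preimage (p j : ℕ) (z : RTensor 𝕜 R (P.X p) (I.X j)) : RTensor 𝕜 R (P.X (p + 1)) (I.X j) :=
  if h : z ≠ 0 ∧ ∃ y, RTensor.map 𝕜 (P.d (p + 1) p).hom LinearMap.id y = z then h.2.choose else 0

/-- Choosing zero over zero keeps the solution built below in the right degree and inside the tail.
-/
lemma preimage_zero (p j : ℕ) : preimage 𝕜 P (I := I) p j 0 = 0 :=
  dif_neg (by simp)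

variable {P} in
lemma map_preimage (p j : ℕ) (z : RTensor 𝕜 R (P.X p) (I.X j))
    (h : ∃ y, RTensor.map 𝕜 (P.d (p + 1) p).hom LinearMap.id y = z) :
    RTensor.map 𝕜 (P.d (p + 1) p).hom LinearMap.id (preimage 𝕜 P p j z) = z := by
  by_cases hz : z = 0
  · rw [hz, preimage_zero, map_zero]
  · rw [preimage, dif_pos ⟨hz, h⟩]
    exact h.choose_spec

variable {P} in
/-- The solution `y` of the equation `D y = x`, constructed column by column. -/
def solve (x : Families 𝕜 P I) : ∀ j p : ℕ, RTensor 𝕜 R (P.X p) (I.X j)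
  -- This value is harmless: in the range where columns are exact, entries of the relevant degree in
  -- the tail have `p > 0`.
  | _, 0 => 0
  | 0, p + 1 => preimage 𝕜 P p 0 (x p 0)
  | j + 1, p + 1 => preimage 𝕜 P p (j + 1) (x p (j + 1) -
      (-1 : 𝕜) ^ p • RTensor.map 𝕜 LinearMap.id (I.d j (j + 1)).hom (solve x j p))

lemma map_d_zero (p : ℕ) (x : RTensor 𝕜 R (P.X p) (I.X (0 - 1))) :
    RTensor.map 𝕜 LinearMap.id (I.d (0 - 1) 0).hom x = 0 := by
  rw [I.shape _ _ (by simp), ModuleCat.hom_zero, RTensor.map_zero_right, LinearMap.zero_apply]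

variable {P}

lemma solve_succ (x : Families 𝕜 P I) (j p : ℕ) :
    solve 𝕜 x j (p + 1) = preimage 𝕜 P p j (x p j -
      (-1 : 𝕜) ^ p • RTensor.map 𝕜 LinearMap.id (I.d (j - 1) j).hom (solve 𝕜 x (j - 1) p)) := by
  cases j with
  | zero => rw [map_d_zero, smul_zero, sub_zero, solve]
  | succ j => rw [solve]; rfl

lemma solve_eq_zero (x : Families 𝕜 P I) (m : ℤ) (hx : x ∈ homogeneous 𝕜 P I m)
    (hx' : x ∈ tail 𝕜 P I k) (j p : ℕ) (h : (p : ℤ) - j ≠ m + 1 ∨ j < k) :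
    solve 𝕜 x j p = 0 := by
  induction j generalizing p with
  | zero =>
    cases p with
    | zero => rw [solve]
    | succ p =>
      have : x p 0 = 0 := h.elim (fun h => hx p 0 (by push_cast at h ⊢; omega)) (hx' p 0)
      rw [solve, this, preimage_zero]
  | succ j ih =>
    cases p with
    | zero => rw [solve]
    | succ p =>
      have h1 : x p (j + 1) = 0 :=
        h.elim (fun h => hx p _ (by push_cast at h ⊢; omega)) (hx' p _)
      have h2 : solve 𝕜 x j p = 0 :=
        ih p (h.imp (fun h => by push_cast at h ⊢; omega) fun h => by omega)
      rw [solve, h1, h2, map_zero, smul_zero, sub_zero, preimage_zero]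

/-- Induction on the column. The right-hand side is a cycle of its column, by `D x = 0` and the
equation already solved in the previous column. Off the degree or the tail it is simply zero. -/
lemma map_solve (x : Families 𝕜 P I) (m : ℤ) (n : ℕ) (hm : n < m + k)
    (hI : ∀ q, n ≤ q → ∀ j, TensorExactAt 𝕜 P (I.X j) q)
    (hx : x ∈ homogeneous 𝕜 P I m) (hx' : x ∈ tail 𝕜 P I k) (hD : totalD 𝕜 P I x = 0) (j p : ℕ) :
    RTensor.map 𝕜 (P.d (p + 1) p).hom LinearMap.id (solve 𝕜 x j (p + 1)) = x p j -
      (-1 : 𝕜) ^ p • RTensor.map 𝕜 LinearMap.id (I.d (j - 1) j).hom (solve 𝕜 x (j - 1) p) := by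
  induction j generalizing p with
  | zero =>
    rw [solve_succ]
    refine map_preimage 𝕜 p 0 _ ?_
    rw [map_d_zero, smul_zero, sub_zero]
    by_cases h : (p : ℤ) - (0 : ℕ) ≠ m ∨ 0 < k
    · have : x p 0 = 0 := h.elim (hx p 0) (hx' p 0)
      exact ⟨0, by rw [this, map_zero]⟩
    · push Not at h
      obtain ⟨q, rfl⟩ : ∃ q, p = q + 1 := ⟨p - 1, by omega⟩
      refine hI q (by push_cast at h; omega) 0 _ ?_
      have := congrFun (congrFun hD q) 0
      rwa [totalD_apply, map_d_zero, smul_zero, add_zero] at this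
  | succ j ih =>
    rw [solve_succ]
    refine map_preimage 𝕜 p (j + 1) _ ?_
    by_cases h : (p : ℤ) - (j + 1 : ℕ) ≠ m ∨ j + 1 < k
    · have h1 : x p (j + 1) = 0 := h.elim (hx p _) (hx' p _)
      have h2 : solve 𝕜 x (j + 1 - 1) p = 0 := solve_eq_zero 𝕜 k x m hx hx' j p
        (h.imp (fun h => by push_cast at h ⊢; omega) fun h => by omega)
      exact ⟨0, by rw [h1, h2, map_zero, map_zero, smul_zero, sub_zero]⟩
    · push Not at h
      -- Here `p = m + (j + 1) ≥ m + k > n`, so `q ≥ n` and the column is exact at `P_p`.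
      obtain ⟨q, rfl⟩ : ∃ q, p = q + 1 := ⟨p - 1, by omega⟩
      refine hI q (by push_cast at h; omega) _ _ ?_
      have h1 := congrFun (congrFun hD q) (j + 1)
      rw [totalD_apply] at h1
      have h2 := ih q
      have hcomm (z : RTensor 𝕜 R (P.X (q + 1)) (I.X j)) :
          RTensor.map 𝕜 (P.d (q + 1) q).hom LinearMap.id
            (RTensor.map 𝕜 LinearMap.id (I.d j (j + 1)).hom z) =
          RTensor.map 𝕜 LinearMap.id (I.d j (j + 1)).hom
            (RTensor.map 𝕜 (P.d (q + 1) q).hom LinearMap.id z) := by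
        rw [← LinearMap.comp_apply, ← LinearMap.comp_apply, ← RTensor.map_comp,
          ← RTensor.map_comp]
        rfl
      have hdd (z : RTensor 𝕜 R (P.X q) (I.X (j - 1))) :
          RTensor.map 𝕜 LinearMap.id (I.d j (j + 1)).hom
            (RTensor.map 𝕜 LinearMap.id (I.d (j - 1) j).hom z) = 0 := by
        rw [← LinearMap.comp_apply, ← RTensor.map_comp, ← ModuleCat.hom_comp, I.d_comp_d,
          ModuleCat.hom_zero, RTensor.map_zero_right, LinearMap.zero_apply]
      change RTensor.map 𝕜 (P.d (q + 1) q).hom LinearMap.id (x (q + 1) (j + 1)) +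
        (-1 : 𝕜) ^ q • RTensor.map 𝕜 LinearMap.id (I.d j (j + 1)).hom (x q j) = 0 at h1
      change RTensor.map 𝕜 (P.d (q + 1) q).hom LinearMap.id (x (q + 1) (j + 1) -
        (-1 : 𝕜) ^ (q + 1) • RTensor.map 𝕜 LinearMap.id (I.d j (j + 1)).hom
          (solve 𝕜 x j (q + 1))) = 0
      -- After the induction hypothesis and `∂∂ = 0`, what remains is the component of `D x` at `(q,
      -- j + 1)`.
      rw [map_sub, map_smul, hcomm, h2, map_sub, map_smul, hdd, smul_zero, sub_zero]
      rw [pow_succ, mul_neg_one, neg_smul, sub_neg_eq_add]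
      exact h1

/-- The family `solve` may have infinitely many nonzero entries even when `x` does not; the argument
is available for products, not for sums. -/
lemma isZero_homology_barTensorTail (m : ℤ) (n : ℕ) (hm : n < m + k)
    (hI : ∀ q, n ≤ q → ∀ j, TensorExactAt 𝕜 P (I.X j) q) :
    IsZero ((barTensorTail 𝕜 P I k).homology m) := by
  refine isZero_homology_gradedComplex 𝕜 _ _ _ _ m fun x hx hD => ?_
  refine ⟨fun p j => solve 𝕜 x j p, ⟨fun p j h => ?_, fun p j h => ?_⟩, ?_⟩
  · exact solve_eq_zero 𝕜 k x m hx.1 hx.2 j p (Or.inl h)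
  · exact solve_eq_zero 𝕜 k x m hx.1 hx.2 j p (Or.inr h)
  · funext p j
    rw [totalD_apply, map_solve 𝕜 k x m n hm hI hx.1 hx.2 hD]
    abel

variable (P) in
/-- The connecting homomorphism of the sequence of tails, naturally in the module. -/
def stableConnecting (i : ℤ) :
    resolution R ⋙ stableTensor 𝕜 P ⋙ HomologicalComplex.homologyFunctor _ _ (i + 1) ⟶
      resolution R ⋙ tensorTailFunctor 𝕜 P k ⋙ HomologicalComplex.homologyFunctor _ _ i where
  app N := (tailSequence_shortExact 𝕜 P ((resolution R).obj N) k).δ (i + 1) i rfl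
  naturality _ _ f := (HomologicalComplex.HomologySequence.δ_naturality
    (tailSequenceMap 𝕜 P k ((resolution R).map f)) (tailSequence_shortExact 𝕜 P _ k)
    (tailSequence_shortExact 𝕜 P _ k) (i + 1) i rfl).symm

/-- The middle term of the sequence of tails is acyclic in degrees `i` and `i + 1`. -/
lemma isIso_stableConnecting {n : ℕ} (hP : InjectiveVanishing 𝕜 (R := R) P n) (i : ℤ)
    (hi : n < i + k) : IsIso (stableConnecting (R := R) 𝕜 P k i) := by
  have (N : ModuleCat.{u} R) : IsIso ((stableConnecting 𝕜 P k i).app N) := by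
    have hI : ∀ q, n ≤ q → ∀ j, TensorExactAt 𝕜 P (((resolution R).obj N).X j) q :=
      fun q hq j => hP q hq _ (inferInstanceAs (Injective ((J R).obj ((cosyzygy R j).obj N))))
    exact ShortComplex.ShortExact.isIso_δ
      (tailSequence_shortExact 𝕜 P ((resolution R).obj N) k) (i + 1) i rfl
      (isZero_homology_barTensorTail 𝕜 k (i + 1) n (by omega) hI)
      (isZero_homology_barTensorTail 𝕜 k i n hi hI)
  exact NatIso.isIso_of_isIso_app _

end Tails

/-- Homology is computed as cycles modulo boundaries, so injectivity and surjectivity become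
statements about representatives. -/
lemma quasiIso_of_elements {𝕜 : Type w} [CommRing 𝕜] {S S' : ShortComplex (ModuleCat.{u} 𝕜)}
    (φ : S ⟶ S')
    (inj : ∀ x : S.X₂, S.g x = 0 → (∃ z, S'.f z = φ.τ₂ x) → ∃ w, S.f w = x)
    (surj : ∀ x' : S'.X₂, S'.g x' = 0 → ∃ x, S.g x = 0 ∧ ∃ z, x' = φ.τ₂ x + S'.f z) :
    ShortComplex.QuasiIso φ := by
  let γ : ShortComplex.LeftHomologyMapData φ S.moduleCatLeftHomologyData
    S'.moduleCatLeftHomologyData := default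
  rw [γ.quasiIso_iff, ConcreteCategory.isIso_iff_bijective]
  have hK (x : S.moduleCatLeftHomologyData.K) : (γ.φK x).1 = φ.τ₂ x.1 :=
    ConcreteCategory.congr_hom γ.commi x
  have hπ (x : S.moduleCatLeftHomologyData.K) :
      γ.φH (S.moduleCatLeftHomologyData.π x) = S'.moduleCatLeftHomologyData.π (γ.φK x) :=
    ConcreteCategory.congr_hom γ.commπ x
  constructor
  · change Function.Injective γ.φH.hom
    rw [injective_iff_map_eq_zero]
    intro h hh
    obtain ⟨x, rfl⟩ := Submodule.mkQ_surjective _ h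
    have h1 := (hπ x).symm.trans hh
    obtain ⟨z, hz⟩ := (Submodule.Quotient.mk_eq_zero _).1 h1
    obtain ⟨y, hy⟩ := inj x.1 x.2 ⟨z, (congrArg Subtype.val hz).trans (hK x)⟩
    exact (Submodule.Quotient.mk_eq_zero _).2 ⟨y, Subtype.ext hy⟩
  · intro h
    obtain ⟨x', rfl⟩ := Submodule.mkQ_surjective _ h
    obtain ⟨x, hx, z, hz⟩ := surj x'.1 x'.2
    refine ⟨S.moduleCatLeftHomologyData.π ⟨x, hx⟩, (hπ _).trans ?_⟩
    refine ((Submodule.Quotient.eq _).2 ⟨-z, Subtype.ext ?_⟩)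
    refine (map_neg S'.f.hom z).trans ?_
    refine Eq.trans ?_ (congrArg (· - x'.1) (hK ⟨x, hx⟩)).symm
    refine Eq.trans ?_ (congrArg (fun t => φ.τ₂ x - t) hz).symm
    change - S'.f z = _
    abel

/-! ### Reducing the tail of `P ⊗_R I` to its first column by means of exact rows. -/

section Augmentation

variable (𝕜 : Type w) {R : Type u} [CommRing 𝕜] [Ring R] [Algebra 𝕜 R]

variable {P : ChainComplex (ModuleCat.{u} Rᵐᵒᵖ) ℕ} {I : CochainComplex (ModuleCat.{u} R) ℕ}

variable (P I) in
/-- The family with a single entry. -/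
def single (p j : ℕ) : RTensor 𝕜 R (P.X p) (I.X j) →ₗ[𝕜] Families 𝕜 P I :=
  LinearMap.single 𝕜 (fun p : ℕ => ∀ j : ℕ, RTensor 𝕜 R (P.X p) (I.X j)) p ∘ₗ
    LinearMap.single 𝕜 (fun j : ℕ => RTensor 𝕜 R (P.X p) (I.X j)) j

lemma single_same (p j : ℕ) (t : RTensor 𝕜 R (P.X p) (I.X j)) : single 𝕜 P I p j t p j = t := by
  simp [single]

lemma single_ne (p j : ℕ) (t : RTensor 𝕜 R (P.X p) (I.X j)) (p' j' : ℕ) (h : p' ≠ p ∨ j' ≠ j) :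
    single 𝕜 P I p j t p' j' = 0 := by
  by_cases hp : p' = p
  · subst hp
    simp [single, Pi.single_eq_of_ne (h.resolve_left (by simp))]
  · simp [single, Pi.single_eq_of_ne hp]

lemma single_mem (p j k : ℕ) (n : ℤ) (hn : (p : ℤ) - j = n) (hk : k ≤ j)
    (t : RTensor 𝕜 R (P.X p) (I.X j)) :
    single 𝕜 P I p j t ∈ finitelySupported 𝕜 P I n ⊓ tail 𝕜 P I k := by
  refine ⟨⟨fun p' j' h => single_ne 𝕜 p j t p' j' ?_, (Set.finite_singleton (p, j)).subset ?_⟩,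
    fun p' j' h => single_ne 𝕜 p j t p' j' (Or.inr (by omega))⟩
  · by_contra! h'
    exact h (by rw [h'.1, h'.2, hn])
  · rintro ⟨p', j'⟩ h
    by_contra h'
    refine h (single_ne 𝕜 p j t p' j' ?_)
    by_contra! h''
    exact h' (Prod.ext h''.1 h''.2)

lemma totalD_single_apply_succ (p j : ℕ) (t : RTensor 𝕜 R (P.X p) (I.X j)) :
    totalD 𝕜 P I (single 𝕜 P I p j t) p (j + 1) =
      (-1 : 𝕜) ^ p • RTensor.map 𝕜 LinearMap.id (I.d j (j + 1)).hom t := by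
  rw [totalD_apply, single_ne 𝕜 p j t _ _ (Or.inl (by omega)), map_zero, zero_add]
  exact congrArg (fun s => (-1 : 𝕜) ^ p • RTensor.map 𝕜 LinearMap.id (I.d j (j + 1)).hom s)
    (single_same 𝕜 p j t)

lemma totalD_single_apply_of_lt (p j : ℕ) (t : RTensor 𝕜 R (P.X p) (I.X j)) (p' j' : ℕ)
    (h : j < j') (h' : p' ≠ p ∨ j' ≠ j + 1) :
    totalD 𝕜 P I (single 𝕜 P I p j t) p' j' = 0 := by
  rw [totalD_apply, single_ne 𝕜 p j t _ _ (Or.inr (by omega)), map_zero, zero_add,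
    single_ne 𝕜 p j t _ _ (h'.imp id (by omega)), map_zero, smul_zero]

/-- The boundary of a single entry has two components; the horizontal one vanishes by `ht`. -/
lemma totalD_single (p j : ℕ) (t : RTensor 𝕜 R (P.X (p + 1)) (I.X j))
    (ht : RTensor.map 𝕜 LinearMap.id (I.d j (j + 1)).hom t = 0) :
    totalD 𝕜 P I (single 𝕜 P I (p + 1) j t) =
      single 𝕜 P I p j (RTensor.map 𝕜 (P.d (p + 1) p).hom LinearMap.id t) := by
  funext p' j'
  rw [totalD_apply]
  have h2 : RTensor.map 𝕜 LinearMap.id (I.d (j' - 1) j').hom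
      (single 𝕜 P I (p + 1) j t p' (j' - 1)) = 0 := by
    cases j' with
    | zero => exact map_d_zero 𝕜 P p' _
    | succ j' =>
      by_cases h : p' ≠ p + 1 ∨ j' ≠ j
      · rw [single_ne 𝕜 (p + 1) j t p' (j' + 1 - 1) h, map_zero]
      · push Not at h
        obtain ⟨rfl, rfl⟩ := h
        exact (congrArg _ (single_same 𝕜 (p + 1) j' t)).trans ht
  rw [h2, smul_zero, add_zero]
  by_cases h : p' ≠ p ∨ j' ≠ j
  · rw [single_ne 𝕜 p j _ p' j' h, single_ne 𝕜 (p + 1) j t (p' + 1) j' (h.imp (by omega) id),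
      map_zero]
  · push Not at h
    obtain ⟨rfl, rfl⟩ := h
    rw [single_same, single_same]

variable [hP : ∀ p, Module.Projective Rᵐᵒᵖ (P.X p)] {k : ℕ} {A : Type u} [AddCommGroup A]
  [Module R A] (ε : A →ₗ[R] I.X k)

/-- The last nonzero column is removed repeatedly: its entry is a cycle of an exact row, hence
equals `(1 ⊗ ∂) v`, and subtracting a boundary moves it one column back. Only the vanishing of `D y`
beyond column `k` is assumed, so the lemma applies both to cycles and to chains bounding an element
coming from `A`. -/
lemma eq_single_add_totalD (hε : Function.Exact ε (I.d k (k + 1)).hom)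
    (hI : ∀ j, k ≤ j → Function.Exact (I.d j (j + 1)).hom (I.d (j + 1) (j + 1 + 1)).hom)
    (q : ℕ) (n : ℤ) (hn : (q : ℤ) - k = n) (y : Families 𝕜 P I)
    (hy : y ∈ finitelySupported 𝕜 P I n ⊓ tail 𝕜 P I k)
    (hD : ∀ p j, k < j → totalD 𝕜 P I y p j = 0) :
    ∃ s : RTensor 𝕜 R (P.X q) A, ∃ z ∈ finitelySupported 𝕜 P I (n + 1) ⊓ tail 𝕜 P I k,
      y = single 𝕜 P I q k (RTensor.map 𝕜 LinearMap.id ε s) + totalD 𝕜 P I z := by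
  -- Finite support bounds the columns; `K` is the induction parameter.
  obtain ⟨K, hK⟩ : ∃ K, ∀ p j, k + K < j → y p j = 0 := by
    obtain ⟨K, hK⟩ := (hy.1.2.image Prod.snd).bddAbove
    refine ⟨K, fun p j h => ?_⟩
    by_contra h'
    have := hK ⟨(p, j), h', rfl⟩
    simp only at this
    omega
  induction K generalizing y with
  | zero =>
    have h1 : RTensor.map 𝕜 LinearMap.id (I.d k (k + 1)).hom (y q k) = 0 := by
      have h := hD q (k + 1) (by omega)
      rw [totalD_apply, hK _ _ (by omega), map_zero, zero_add] at h
      -- Multiplying by the sign once more cancels it, since its square is 1.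
      have h' := congrArg (fun t => (-1 : 𝕜) ^ q • t) h
      simp only [smul_smul, ← mul_pow, smul_zero] at h'
      simpa using h'
    obtain ⟨s, hs⟩ := (RTensor.map_exact 𝕜 (M := P.X q) _ _ hε _).1 h1
    refine ⟨s, 0, Submodule.zero_mem _, ?_⟩
    rw [map_zero, add_zero, hs]
    funext p j
    by_cases h : p ≠ q ∨ j ≠ k
    · rw [single_ne 𝕜 q k _ p j h]
      rcases lt_trichotomy j k with hj | hj | hj
      · exact hy.2 p j hj
      · exact hy.1.1 p j (by omega)
      · exact hK p j hj
    · push Not at h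
      obtain ⟨rfl, rfl⟩ := h
      rw [single_same]
  | succ K ih =>
    have h1 : RTensor.map 𝕜 LinearMap.id (I.d (k + K + 1) (k + K + 1 + 1)).hom
        (y (q + K + 1) (k + K + 1)) = 0 := by
      have h := hD (q + K + 1) (k + K + 1 + 1) (by omega)
      rw [totalD_apply, hK _ _ (by omega), map_zero, zero_add] at h
      have h' := congrArg (fun t => (-1 : 𝕜) ^ (q + K + 1) • t) h
      simp only [smul_smul, ← mul_pow, smul_zero] at h'
      simpa using h'
    obtain ⟨v, hv⟩ :=
      (RTensor.map_exact 𝕜 (M := P.X (q + K + 1)) _ _ (hI (k + K) (by omega)) _).1 h1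
    -- The sign compensates the one in `totalD`, so that `D z₀` agrees with `y` at `(q + K + 1, k +
    -- K + 1)`; its other component lies in column `k + K`.
    let z₀ := single 𝕜 P I (q + K + 1) (k + K) ((-1 : 𝕜) ^ (q + K + 1) • v)
    have hz₀ : z₀ ∈ finitelySupported 𝕜 P I (n + 1) ⊓ tail 𝕜 P I k :=
      single_mem 𝕜 _ _ _ _ (by push_cast; omega) (by omega) _
    obtain ⟨s, z, hz, hyz⟩ := ih (y - totalD 𝕜 P I z₀)
      (Submodule.sub_mem _ hy ⟨totalD_finitelySupported 𝕜 P I _ _ rfl _ hz₀.1,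
        totalD_tail 𝕜 P I k _ hz₀.2⟩)
      (fun p j h => by
        rw [map_sub, totalD_totalD, sub_zero]
        exact hD p j h)
      (fun p j h => by
        by_cases h' : p ≠ q + K + 1 ∨ j ≠ k + K + 1
        · have h2 : totalD 𝕜 P I z₀ p j = 0 := totalD_single_apply_of_lt 𝕜 _ _ _ p j h h'
          have h3 : y p j = 0 := by
            by_cases hj : j = k + K + 1
            · exact hy.1.1 p j (by omega)
            · exact hK p j (by omega)
          change y p j - totalD 𝕜 P I z₀ p j = 0
          rw [h2, h3, sub_zero]
        · push Not at h'
          obtain ⟨rfl, rfl⟩ := h'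
          have h2 : totalD 𝕜 P I z₀ (q + K + 1) (k + K + 1) = y (q + K + 1) (k + K + 1) := by
            refine (totalD_single_apply_succ 𝕜 _ _ _).trans ?_
            rw [map_smul, smul_smul, ← mul_pow, hv]
            simp
          exact sub_eq_zero.2 h2.symm)
    refine ⟨s, z + z₀, Submodule.add_mem _ hz hz₀, ?_⟩
    rw [map_add, ← add_assoc, ← hyz]
    abel

variable (P) in
/-- The map `P_p ⊗ A → (P ⊗ I)_n` given by `ε`, where `p - k = n`. -/
def augmentation (p : ℕ) (n : ℤ) (h : (p : ℤ) - k = n) :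
    ModuleCat.of 𝕜 (RTensor 𝕜 R (P.X p) A) ⟶ (tensorTail 𝕜 P I k).X n :=
  ModuleCat.ofHom (LinearMap.codRestrict (finitelySupported 𝕜 P I n ⊓ tail 𝕜 P I k)
    (single 𝕜 P I p k ∘ₗ RTensor.map 𝕜 LinearMap.id ε)
    (fun _ => single_mem 𝕜 p k k n h le_rfl _))

end Augmentation

/-! ### The map from `P ⊗_R A` to the tail is a quasi-isomorphism. -/

section Comparison

variable (𝕜 : Type w) {R : Type u} [CommRing 𝕜] [Ring R] [Algebra 𝕜 R]

variable {P : ChainComplex (ModuleCat.{u} Rᵐᵒᵖ) ℕ} {I : CochainComplex (ModuleCat.{u} R) ℕ}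
  {k : ℕ} {A : ModuleCat.{u} R} (ε : A ⟶ I.X k)

variable (P I k) in
lemma tensorTail_d_apply (a b : ℤ) (h : b + 1 = a) (x : (tensorTail 𝕜 P I k).X a) :
    ((tensorTail 𝕜 P I k).d a b x).1 = totalD 𝕜 P I x.1 :=
  congrArg Subtype.val (ConcreteCategory.congr_hom (gradedComplex_d 𝕜 _ _ _ _ a b h) x)

lemma map_d_map_ε (hε : ε ≫ I.d k (k + 1) = 0) (p : ℕ) (s : RTensor 𝕜 R (P.X p) A) :
    RTensor.map 𝕜 LinearMap.id (I.d k (k + 1)).hom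
      (RTensor.map 𝕜 (LinearMap.id (M := P.X p)) ε.hom s) = 0 := by
  rw [← LinearMap.comp_apply, ← RTensor.map_comp, ← ModuleCat.hom_comp, hε,
    ModuleCat.hom_zero, RTensor.map_zero_right, LinearMap.zero_apply]

lemma totalD_single_map_ε (hε : ε ≫ I.d k (k + 1) = 0) (p : ℕ)
    (s : RTensor 𝕜 R (P.X (p + 1)) A) :
    totalD 𝕜 P I (single 𝕜 P I (p + 1) k (RTensor.map 𝕜 LinearMap.id ε.hom s)) =
      single 𝕜 P I p k (RTensor.map 𝕜 LinearMap.id ε.hom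
        (RTensor.map 𝕜 (P.d (p + 1) p).hom LinearMap.id s)) := by
  rw [totalD_single 𝕜 p k _ (map_d_map_ε 𝕜 ε hε _ s)]
  simp only [← LinearMap.comp_apply, ← RTensor.map_comp, LinearMap.id_comp, LinearMap.comp_id]

lemma augmentation_comm (hε : ε ≫ I.d k (k + 1) = 0) (p : ℕ) (n m : ℤ)
    (hn : ((p + 1 : ℕ) : ℤ) - k = n) (hm : (p : ℤ) - k = m) :
    augmentation 𝕜 P ε.hom (p + 1) n hn ≫ (tensorTail 𝕜 P I k).d n m =
      ((tensorComplex 𝕜 P).obj A).d (p + 1) p ≫ augmentation 𝕜 P ε.hom p m hm := by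
  ext s
  refine Subtype.ext ((tensorTail_d_apply 𝕜 P I k n m (by push_cast at hn; omega) _).trans ?_)
  exact totalD_single_map_ε 𝕜 ε hε p s

variable (P) in
/-- The comparison map of `P ⊗ A` and the tail of `P ⊗ I`, near the degree `q + 1`. -/
def comparison (hε : ε ≫ I.d k (k + 1) = 0) (q : ℕ) (i : ℤ) (hi : ((q + 1 : ℕ) : ℤ) - k = i) :
    ((tensorComplex 𝕜 P).obj A).sc' (q + 1 + 1) (q + 1) q ⟶
      (tensorTail 𝕜 P I k).sc' (i + 1) i (i - 1) where
  τ₁ := augmentation 𝕜 P ε.hom (q + 1 + 1) (i + 1) (by push_cast at hi ⊢; omega)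
  τ₂ := augmentation 𝕜 P ε.hom (q + 1) i hi
  τ₃ := augmentation 𝕜 P ε.hom q (i - 1) (by push_cast at hi ⊢; omega)
  comm₁₂ := augmentation_comm 𝕜 ε hε _ _ _ _ _
  comm₂₃ := augmentation_comm 𝕜 ε hε _ _ _ _ _

/-- Both halves reduce an element of the tail to one coming from `P ⊗ A`, up to a boundary. Since
`P_p` is flat and `ε` is injective, equations in the tail between elements of column `k` can then be
read in `P ⊗ A`. -/
lemma quasiIso_comparison (hP : ∀ p, Module.Projective Rᵐᵒᵖ (P.X p)) [Mono ε]
    (hε : ε ≫ I.d k (k + 1) = 0) (hεI : Function.Exact ε.hom (I.d k (k + 1)).hom)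
    (hI : ∀ j, k ≤ j → Function.Exact (I.d j (j + 1)).hom (I.d (j + 1) (j + 1 + 1)).hom)
    (q : ℕ) (i : ℤ) (hi : ((q + 1 : ℕ) : ℤ) - k = i) :
    ShortComplex.QuasiIso (comparison 𝕜 P ε hε q i hi) := by
  have hinj (p : ℕ) (s s' : RTensor 𝕜 R (P.X p) A)
      (h : single 𝕜 P I p k (RTensor.map 𝕜 LinearMap.id ε.hom s) =
        single 𝕜 P I p k (RTensor.map 𝕜 LinearMap.id ε.hom s')) : s = s' := by
    have h' := congrFun (congrFun h p) k
    rw [single_same, single_same] at h'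
    exact RTensor.map_injective 𝕜 _ ((ModuleCat.mono_iff_injective ε).1 inferInstance) h'
  have hd := tensorTail_d_apply 𝕜 P I k
  refine quasiIso_of_elements _ ?_ ?_
  · rintro x - ⟨y, hy⟩
    have hy' : totalD 𝕜 P I y.1 =
        single 𝕜 P I (q + 1) k (RTensor.map 𝕜 LinearMap.id ε.hom x) :=
      (hd _ _ rfl y).symm.trans (congrArg Subtype.val hy)
    -- Here `y` is not a cycle, but its boundary is concentrated in column `k`. Replacing `y` by `s`
    -- leaves the boundary unchanged because `D D z = 0`.
    obtain ⟨s, z, hz, hyz⟩ := eq_single_add_totalD 𝕜 ε.hom hεI hI (q + 1 + 1) (i + 1)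
      (by push_cast at hi ⊢; omega) y.1 y.2 (fun p j h => by
        rw [hy']; exact single_ne 𝕜 _ _ _ _ _ (Or.inr h.ne'))
    refine ⟨s, hinj _ _ _ ?_⟩
    rw [← hy', hyz, map_add, totalD_totalD, add_zero, totalD_single_map_ε 𝕜 ε hε]
    rfl
  · intro x hx
    have hx' : totalD 𝕜 P I x.1 = 0 :=
      (hd i (i - 1) (by ring) x).symm.trans (congrArg Subtype.val hx)
    obtain ⟨s, z, hz, hyz⟩ := eq_single_add_totalD 𝕜 ε.hom hεI hI (q + 1) i hi x.1 x.2
      (fun p j h => by rw [hx']; rfl)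
    refine ⟨s, hinj _ _ _ ?_, ⟨z, hz⟩, Subtype.ext (hyz.trans ?_)⟩
    · rw [hyz, map_add, totalD_totalD, add_zero, totalD_single_map_ε 𝕜 ε hε] at hx'
      have h0 : single 𝕜 P I q k (RTensor.map 𝕜 LinearMap.id ε.hom
          (0 : RTensor 𝕜 R (P.X q) A)) = 0 := by rw [map_zero, map_zero]
      exact hx'.trans h0.symm
    · exact congrArg (_ + ·) (hd (i + 1) i rfl ⟨z, hz⟩).symm

end Comparison

/-! ### The comparison for the functorial injective resolution, naturally in the module. -/

section ResolutionComparison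

variable (𝕜 : Type w) {R : Type u} [CommRing 𝕜] [Ring R] [Algebra 𝕜 R]

variable {P : ChainComplex (ModuleCat.{u} Rᵐᵒᵖ) ℕ} {k : ℕ}

variable (R) in
/-- The augmentation `Ω^k N ⟶ I^k` of the truncated injective resolution. -/
abbrev resolutionι (k : ℕ) (N : ModuleCat.{u} R) :
    (cosyzygy R k).obj N ⟶ ((resolution R).obj N).X k :=
  (ι R).app ((cosyzygy R k).obj N)

variable (R) in
lemma resolution_d (k : ℕ) (N : ModuleCat.{u} R) :
    ((resolution R).obj N).d k (k + 1) = (splice R).app ((cosyzygy R k).obj N) := by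
  dsimp only [resolution, CochainComplex.of]
  exact CochainComplex.of_d _ _ _

variable (R) in
lemma ι_splice (N : ModuleCat.{u} R) : (ι R).app N ≫ (splice R).app N = 0 := by
  simp only [splice]
  rw [reassoc_of% ι_π R N, zero_comp]

variable (R) in
lemma resolutionι_d (k : ℕ) (N : ModuleCat.{u} R) :
    resolutionι R k N ≫ ((resolution R).obj N).d k (k + 1) = 0 := by
  rw [resolution_d]
  exact ι_splice R _

variable (P) in
/-- The comparison maps, naturally in the module. -/
def comparisonNatTrans (q : ℕ) (i : ℤ) (hi : ((q + 1 : ℕ) : ℤ) - k = i) :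
    (cosyzygy R k ⋙ tensorComplex 𝕜 P) ⋙
        HomologicalComplex.shortComplexFunctor' _ _ (q + 1 + 1) (q + 1) q ⟶
      (resolution R ⋙ tensorTailFunctor 𝕜 P k) ⋙
        HomologicalComplex.shortComplexFunctor' _ _ (i + 1) i (i - 1) where
  app N := comparison 𝕜 P (resolutionι R k N) (resolutionι_d R k N) q i hi
  naturality N N' f := by
    have key (p : ℕ) (s : RTensor 𝕜 R (P.X p) ((cosyzygy R k).obj N)) :
        single 𝕜 P _ p k (RTensor.map 𝕜 LinearMap.id (resolutionι R k N').hom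
          (RTensor.map 𝕜 LinearMap.id ((cosyzygy R k).map f).hom s)) =
        familiesMap 𝕜 P ((resolution R).map f)
          (single 𝕜 P _ p k (RTensor.map 𝕜 LinearMap.id (resolutionι R k N).hom s)) := by
      have h1 : RTensor.map 𝕜 LinearMap.id (resolutionι R k N').hom
          (RTensor.map 𝕜 (LinearMap.id (M := P.X p)) ((cosyzygy R k).map f).hom s) =
          RTensor.map 𝕜 LinearMap.id (((resolution R).map f).f k).hom
            (RTensor.map 𝕜 LinearMap.id (resolutionι R k N).hom s) := by
        rw [← LinearMap.comp_apply, ← LinearMap.comp_apply, ← RTensor.map_comp,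
          ← RTensor.map_comp, ← ModuleCat.hom_comp, ← ModuleCat.hom_comp]
        exact congrArg (fun g => RTensor.map 𝕜 LinearMap.id (ModuleCat.Hom.hom g) s)
          ((ι R).naturality ((cosyzygy R k).map f))
      funext p' j'
      rw [familiesMap_apply]
      by_cases h : p' ≠ p ∨ j' ≠ k
      · rw [single_ne 𝕜 _ _ _ _ _ h, single_ne 𝕜 _ _ _ _ _ h, map_zero]
      · push Not at h
        obtain ⟨rfl, rfl⟩ := h
        rw [single_same, single_same, h1]
    refine ShortComplex.hom_ext _ _ ?_ ?_ ?_
    · ext s; exact Subtype.ext (key _ s)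
    · ext s; exact Subtype.ext (key _ s)
    · ext s; exact Subtype.ext (key _ s)

lemma quasiIso_comparisonNatTrans_app (hP : ∀ p, Module.Projective Rᵐᵒᵖ (P.X p)) (q : ℕ) (i : ℤ)
    (hi : ((q + 1 : ℕ) : ℤ) - k = i) (N : ModuleCat.{u} R) :
    ShortComplex.QuasiIso ((comparisonNatTrans 𝕜 P q i hi).app N) := by
  have : Mono (resolutionι R k N) := inferInstanceAs (Mono ((ι R).app ((cosyzygy R k).obj N)))
  refine quasiIso_comparison 𝕜 (resolutionι R k N) hP (resolutionι_d R k N) ?_ ?_ q i hi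
  · rw [resolution_d]
    exact (ShortComplex.ShortExact.moduleCat_exact_iff_function_exact _).1
      (ι_splice_exact R ((cosyzygy R k).obj N) (ι_splice R _))
  · intro j _
    rw [resolution_d, resolution_d]
    exact (ShortComplex.ShortExact.moduleCat_exact_iff_function_exact _).1
      (splice_exact R ((cosyzygy R j).obj N))

variable (k) in
/-- `Tor_(q+1)(M, Ω^k -)` is the homology of the tail of `P ⊗_R I`. -/
lemma nonempty_cosyzygy_Tor_iso (hP : ∀ p, Module.Projective Rᵐᵒᵖ (P.X p)) (q : ℕ) (i : ℤ)
    (hi : ((q + 1 : ℕ) : ℤ) - k = i) :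
    Nonempty (cosyzygy R k ⋙ tensorComplex 𝕜 P ⋙
        HomologicalComplex.homologyFunctor _ _ (q + 1) ≅
      resolution R ⋙ tensorTailFunctor 𝕜 P k ⋙ HomologicalComplex.homologyFunctor _ _ i) := by
  let τ := Functor.whiskerRight (comparisonNatTrans (R := R) 𝕜 P q i hi)
    (ShortComplex.homologyFunctor _)
  have : IsIso τ := by
    have (N : ModuleCat.{u} R) : IsIso (τ.app N) :=
      (quasiIso_comparisonNatTrans_app 𝕜 hP q i hi N).isIso'
    exact NatIso.isIso_of_isIso_app _
  exact ⟨Functor.isoWhiskerLeft (cosyzygy R k ⋙ tensorComplex 𝕜 P)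
      (HomologicalComplex.homologyFunctorIso' _ _ (q + 1 + 1) (q + 1) q (by simp) (by simp)) ≪≫
    asIso τ ≪≫ (Functor.isoWhiskerLeft (resolution R ⋙ tensorTailFunctor 𝕜 P k)
      (HomologicalComplex.homologyFunctorIso' _ _ (i + 1) i (i - 1) (by simp) (by simp))).symm⟩

end ResolutionComparison

end

end CompleteHomology

theorem mainTheorem6 {𝕜 : Type w} [CommRing 𝕜] {R : Type u} [Ring R] [Algebra 𝕜 R]
    [IsNoetherianRing Rᵐᵒᵖ] (M : ModuleCat.{u} Rᵐᵒᵖ) [Module.Finite Rᵐᵒᵖ M]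
    (hM : ∃ n : ℕ, ∀ i : ℕ, n ≤ i →
      Subsingleton (CategoryTheory.Abelian.Ext M (ModuleCat.of Rᵐᵒᵖ R) i)) (i : ℤ) :
    Nonempty (CompleteHomology.completeTor 𝕜 M i ≅ CompleteHomology.stableTor 𝕜 M i) := by
  open CompleteHomology in
  obtain ⟨n, hn⟩ := exists_injectiveVanishing (𝕜 := 𝕜) M hM
  -- With this `k` one has `k + i ≥ n + 1`. Writing the degree as `q + 1` lets `Tor` unfold to
  -- homology and provides the lower neighbour `q` used in the comparison.
  obtain ⟨k, q, hk, hq⟩ : ∃ k q : ℕ, n < k + i ∧ k + i = Int.ofNat (q + 1) :=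
    ⟨(n + 1 - i).toNat, ((n + 1 - i).toNat + i - 1).toNat, by omega, by
      simp only [Int.ofNat_eq_natCast]; omega⟩
  obtain ⟨e₁⟩ := nonempty_completeTor_iso 𝕜 hn i k hk
  rw [hq] at e₁
  have hP (p : ℕ) : Module.Projective Rᵐᵒᵖ ((projRes M).X p) :=
    (IsProjective.iff_projective _).2 ((projectiveResolution M).projective p)
  obtain ⟨e₂⟩ := nonempty_cosyzygy_Tor_iso (R := R) 𝕜 k hP q i (by
    simp only [Int.ofNat_eq_natCast] at hq; omega)
  have := isIso_stableConnecting 𝕜 k hn i (by omega)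
  exact ⟨e₁ ≪≫ e₂ ≪≫ (asIso (stableConnecting 𝕜 (projRes M) k i)).symm⟩
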